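/- Let $\mathbb K$ be a field of characteristic zero and $A$ an associative unital $\mathbb K$-algebra. Put $T(A)=\bigoplus_{n\ge1}A^{\otimes n}$ and $\mathcal{NC}(A)=\bigoplus_{n\ge1}\mathbb K[NC_n]\otimes A^{\otimes n}$, where $NC_n$ is the set of non-crossing partitions of $[n]=\{1,\dots,n\}$. For a vector space $V$ let $T(V)=\bigoplus_{m\ge1}V^{\otimes m}$ and $\overline T(V)=\mathbb K\mathbf 1\oplus T(V)$, with words written $v_1|\cdots|v_m$ and concatenation as product. For $S\subseteq[n]$ let $J_1,\dots,J_k$ be the connected components (maximal intervals of consecutive integers), from left to right, of $[n]\setminus S$; for $a=a_1\cdots a_n$ let $a_S$ be the subword indexed by $S$. For $L\in NC_n$ and $J\subseteq[n]$ let $st(L|_J)$ be the restriction of $L$ to $J$ (its blocks are the non-empty intersections of $J$ with blocks of $L$), relabelled increasingly as a partition of $[|J|]$. For blocks $B,C$ of $L$ write $B<_LC$ if $\inf C<m<\sup C$ for all $m\in B$. A set $Q$ of blocks of $L$ is admissible if $B\not<_LC$ whenever $B\in Q$ and $C\in L\setminus Q$; write $\cup Q$ for the union of its blocks. Define $$\Delta(a)=\sum_{S\subseteq[n]}a_S\otimes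 a_{J_1}|\cdots|a_{J_k}\qquad(a=a_1\cdots a_n\in T(A)),$$ $$\Delta(L\otimes a)=\sum_{Q\text{ admissible}}\big(st(L|_S)\otimes a_S\big)\otimes\big(st(L|_{J_1})\otimes a_{J_1}|\cdots|st(L|_{J_k})\otimes a_{J_k}\big),\quad S=\cup Q,$$ where an empty word is read as $\mathbf 1$. Let $\Delta^+_\prec$ and $\Delta^+_\succ$ be given by the same sums restricted to $1\in S$ and to $1\notin S$, respectively. For $V=T(A)$ and $V=\mathcal{NC}(A)$ extend these to $\overline T(V)$ and $T(V)$ by $\Delta(v_1|\cdots|v_m)=\Delta(v_1)\cdots\Delta(v_m)$, $\Delta(\mathbf 1)=\mathbf 1\otimes\mathbf 1$, $\Delta^+_\prec(v_1|\cdots|v_m)=\Delta^+_\prec(v_1)\Delta(v_2)\cdots\Delta(v_m)$ and likewise for $\Delta^+_\succ$, and on $T(V)$ put $\Delta_\prec(x)=\Delta^+_\prec(x)-x\otimes\mathbf 1$, $\Delta_\succ(x)=\Delta^+_\succ(x)-\mathbf 1\otimes x$. On $\mathcal L_V=\mathrm{Lin}(T(V),\mathbb K)$ define $f\prec g=m_{\mathbb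 K}\circ(f\otimes g)\circ\Delta_\prec$ and $f\succ g=m_{\mathbb K}\circ(f\otimes g)\circ\Delta_\succ$ (with $f,g$ extended by $0$ at $\mathbf 1$). Let $\overline{\mathcal L_V}=\mathcal L_V\oplus\mathbb Ke=\mathrm{Lin}(\overline T(V),\mathbb K)$, where $e$ is the augmentation, with $f\prec e=f=e\succ f$ and $e\prec f=0=f\succ e$ for $f\in\mathcal L_V$ (the half-products of $e$ with itself are not specified). Let $Sp:\overline T(T(A))\to\overline T(\mathcal{NC}(A))$ be the unital algebra morphism with $Sp(a_1\cdots a_n)=\sum_{L\in NC_n}L\otimes(a_1\cdots a_n)$ for $a_1\cdots a_n\in T(A)$. Theorem. Both $\overline{\mathcal L_{\mathcal{NC}(A)}}$ and $\overline{\mathcal L_{T(A)}}$ are shuffle (dendriform) algebras with unit: for $f,g,h\in\mathcal L_V$, the forms $f\prec g$ and $f\succ g$ lie in $\mathcal L_V$, and $$(f\prec g)\prec h=f\prec(g\prec h+g\succ h),\quad (f\succ g)\prec h=f\succ(g\prec h),\quad f\succ(g\succ h)=(f\prec g+f\succ g)\succ h.$$ The dual map $Sp^*:\overline{\mathcal L_{\mathcal{NC}(A)}}\to\overline{\mathcal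 L_{T(A)}}$, $Sp^*(f)=f\circ Sp$, is a morphism of shuffle algebras with unit: it is linear, $Sp^*(e)=e$, $Sp^*(\mathcal L_{\mathcal{NC}(A)})\subseteq\mathcal L_{T(A)}$, and $Sp^*(f\prec g)=Sp^*(f)\prec Sp^*(g)$, $Sp^*(f\succ g)=Sp^*(f)\succ Sp^*(g)$ for all $f,g\in\overline{\mathcal L_{\mathcal{NC}(A)}}$ at least one of which lies in $\mathcal L_{\mathcal{NC}(A)}$. -/

import Mathlib

open scoped TensorProduct

namespace SplittingProcess

/-! ## Combinatorics of subsets of `{0, …, n-1}` and of non-crossing partitions -/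

section Combinatorics

variable {n : ℕ}

/-- The connected component of `i` in the complement of `S` in `Fin n`: all `j` such that no
element of `S` lies (weakly) between `i` and `j`. It is empty when `i ∈ S`. -/
def component (S : Finset (Fin n)) (i : Fin n) : Finset (Fin n) :=
  Finset.univ.filter fun j => ∀ k ∈ Finset.uIcc i j, k ∉ S

/-- The smallest elements of the connected components of the complement of `S`. -/
def leaders (S : Finset (Fin n)) : Finset (Fin n) :=
  Finset.univ.filter fun i => i ∉ S ∧ ∀ j ∈ component S i, i ≤ j

/-- The list `J₁, …, J_k` of the connected components of the complement of `S` in `Fin n`,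
from left to right. -/
def components (S : Finset (Fin n)) : List (Finset (Fin n)) :=
  ((leaders S).sort (· ≤ ·)).map (component S)

/-- `p` and `q` lie in the same block of `L`. -/
def SameBlock (L : Finpartition (Finset.univ : Finset (Fin n))) (p q : Fin n) : Prop :=
  ∃ B ∈ L.parts, p ∈ B ∧ q ∈ B

/-- A set partition is non-crossing if there are no `p₁ < q₁ < p₂ < q₂` with
`p₁ ∼ p₂ ≁ q₁ ∼ q₂`. -/
def IsNonCrossing (L : Finpartition (Finset.univ : Finset (Fin n))) : Prop :=
  ¬ ∃ p₁ q₁ p₂ q₂ : Fin n, p₁ < q₁ ∧ q₁ < p₂ ∧ p₂ < q₂ ∧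
    SameBlock L p₁ p₂ ∧ ¬ SameBlock L p₂ q₁ ∧ SameBlock L q₁ q₂

/-- Non-crossing partitions of `Fin n`. -/
def NC (n : ℕ) : Type :=
  {L : Finpartition (Finset.univ : Finset (Fin n)) // IsNonCrossing L}

noncomputable instance (n : ℕ) : Fintype (NC n) := by
  classical exact inferInstanceAs
    (Fintype {L : Finpartition (Finset.univ : Finset (Fin n)) // IsNonCrossing L})

/-- The standardized trace on `S` of a set `B`: the preimage of `B` under the increasing
bijection from `Fin S.card` to `S`. -/
def pullBlock (S B : Finset (Fin n)) : Finset (Fin S.card) :=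
  Finset.univ.filter fun j => S.orderEmbOfFin rfl j ∈ B

/-- The restriction of a set partition to `S` (whose blocks are the non-empty `B ∩ S` for the
blocks `B`), standardized to a set partition of `Fin S.card`. -/
def stdRestrict (L : Finpartition (Finset.univ : Finset (Fin n))) (S : Finset (Fin n)) :
    Finpartition (Finset.univ : Finset (Fin S.card)) :=
  Finpartition.ofErase (L.parts.image (pullBlock S))
    (by
      rw [Finset.supIndep_iff_pairwiseDisjoint]
      intro x hx y hy hxy
      simp only [Finset.coe_image, Set.mem_image, Finset.mem_coe] at hx hy
      obtain ⟨B, hB, rfl⟩ := hx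
      obtain ⟨C, hC, rfl⟩ := hy
      rw [Function.onFun, id, id, Finset.disjoint_left]
      intro a ha hb
      simp only [pullBlock, Finset.mem_filter, Finset.mem_univ, true_and] at ha hb
      exact hxy (by rw [L.eq_of_mem_parts hB hC ha hb]))
    (by
      ext a
      simp only [Finset.mem_sup, Finset.mem_image, id, Finset.mem_univ, iff_true]
      obtain ⟨B, hB, ha⟩ := L.exists_mem (Finset.mem_univ (S.orderEmbOfFin rfl a))
      exact ⟨_, ⟨B, hB, rfl⟩, by simpa [pullBlock] using ha⟩)

theorem sameBlock_stdRestrict (L : Finpartition (Finset.univ : Finset (Fin n)))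
    (S : Finset (Fin n)) (p q : Fin S.card) :
    SameBlock (stdRestrict L S) p q ↔
      SameBlock L (S.orderEmbOfFin rfl p) (S.orderEmbOfFin rfl q) := by
  constructor
  · rintro ⟨B, hB, hp, hq⟩
    simp only [stdRestrict, Finpartition.ofErase, Finset.mem_erase, Finset.mem_image] at hB
    obtain ⟨-, C, hC, rfl⟩ := hB
    simp only [pullBlock, Finset.mem_filter, Finset.mem_univ, true_and] at hp hq
    exact ⟨C, hC, hp, hq⟩
  · rintro ⟨C, hC, hp, hq⟩
    have hp' : p ∈ pullBlock S C := by simpa [pullBlock] using hp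
    have hq' : q ∈ pullBlock S C := by simpa [pullBlock] using hq
    refine ⟨pullBlock S C, ?_, hp', hq'⟩
    simp only [stdRestrict, Finpartition.ofErase, Finset.mem_erase, Finset.mem_image]
    exact ⟨Finset.ne_empty_of_mem hp', C, hC, rfl⟩

theorem isNonCrossing_stdRestrict {L : Finpartition (Finset.univ : Finset (Fin n))}
    (hL : IsNonCrossing L) (S : Finset (Fin n)) : IsNonCrossing (stdRestrict L S) := by
  rintro ⟨p₁, q₁, p₂, q₂, h₁, h₂, h₃, h₄, h₅, h₆⟩
  rw [sameBlock_stdRestrict] at h₄ h₅ h₆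
  exact hL ⟨_, _, _, _, (S.orderEmbOfFin rfl).strictMono h₁,
    (S.orderEmbOfFin rfl).strictMono h₂, (S.orderEmbOfFin rfl).strictMono h₃, h₄, h₅, h₆⟩

/-- Standardized restriction of non-crossing partitions. If `S` is the union of a set `Q` of
blocks of `L`, this is the standardization `st(Q)`. -/
def NC.st (L : NC n) (S : Finset (Fin n)) : NC S.card :=
  ⟨stdRestrict L.1 S, isNonCrossing_stdRestrict L.2 S⟩

/-- The relation `B <_L C` on blocks: every `m ∈ B` satisfies `inf C < m < sup C`. -/
def Nested (B C : Finset (Fin n)) : Prop :=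
  ∀ m ∈ B, (∃ x ∈ C, x < m) ∧ (∃ y ∈ C, m < y)

open Classical in
/-- The sets `Q` of blocks of `L` such that `L = Q ⊔ (L \ Q)` is an admissible partition:
no block in `Q` is nested in a block outside `Q`. -/
noncomputable def admissible (L : NC n) : Finset (Finset (Finset (Fin n))) :=
  L.1.parts.powerset.filter fun Q => ∀ B ∈ Q, ∀ C ∈ L.1.parts \ Q, ¬ Nested B C

theorem mem_component {S : Finset (Fin n)} {i j : Fin n} :
    j ∈ component S i ↔ ∀ k ∈ Finset.uIcc i j, k ∉ S := by
  simp [component]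

theorem component_trans {S : Finset (Fin n)} {i j k : Fin n}
    (h₁ : k ∈ component S i) (h₂ : k ∈ component S j) : j ∈ component S i := by
  rw [mem_component] at *
  intro x hx
  by_cases hxk : x ∈ Finset.uIcc i k
  · exact h₁ x hxk
  · refine h₂ x ?_
    simp only [Finset.mem_uIcc] at *
    rcases le_total i j with h | h <;> rcases le_total i k with h' | h' <;>
      rcases le_total j k with h'' | h'' <;> simp_all <;> grind

theorem components_pairwise (S : Finset (Fin n)) : (components S).Pairwise Disjoint := by
  unfold components
  rw [List.pairwise_map]
  refine (Finset.sort_nodup (leaders S) (· ≤ ·)).imp_of_mem ?_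
  intro i j hi hj hij
  rw [Finset.mem_sort] at hi hj
  simp only [leaders, Finset.mem_filter, Finset.mem_univ, true_and] at hi hj
  rw [Finset.disjoint_left]
  intro k hki hkj
  exact hij (le_antisymm (hi.2 j (component_trans hki hkj)) (hj.2 i (component_trans hkj hki)))

theorem exists_mem_components_iff (S : Finset (Fin n)) (j : Fin n) :
    (∃ J ∈ components S, j ∈ J) ↔ j ∉ S := by
  constructor
  · rintro ⟨J, hJ, hj⟩
    simp only [components, List.mem_map, Finset.mem_sort] at hJ
    obtain ⟨i, -, rfl⟩ := hJ
    exact mem_component.1 hj j Finset.right_mem_uIcc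
  · intro hj
    have hjj : j ∈ component S j := by
      rw [mem_component]; simpa using hj
    obtain ⟨i, hi, hmin⟩ := (component S j).exists_min_image id ⟨j, hjj⟩
    have hiS : i ∉ S := mem_component.1 hi i Finset.right_mem_uIcc
    have hii : i ∈ component S i := by
      rw [mem_component]; simpa using hiS
    have hji : j ∈ component S i := component_trans hii hi
    refine ⟨component S i, ?_, hji⟩
    simp only [components, List.mem_map, Finset.mem_sort]
    refine ⟨i, ?_, rfl⟩
    simp only [leaders, Finset.mem_filter, Finset.mem_univ, true_and]
    refine ⟨hiS, fun k hk => hmin k ?_⟩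
    have hkk : k ∈ component S k := by
      rw [mem_component]; simpa using mem_component.1 hk k Finset.right_mem_uIcc
    exact component_trans hi (component_trans hkk hk)

end Combinatorics

/-! ## Coproducts on tensor algebras defined from words -/

section Words

variable (K : Type*) [Field K] (A : Type*) [AddCommMonoid A] [Module K A]

/-- `f` does not depend on the coordinates outside `S` and is linear in each coordinate in `S`. -/
structure MultilinearOn {n : ℕ} {M : Type*} [AddCommMonoid M] [Module K M]
    (S : Finset (Fin n)) (f : (Fin n → A) → M) : Prop where
  const : ∀ a i x, i ∉ S → f (Function.update a i x) = f a
  add : ∀ a i x y, i ∈ S →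
    f (Function.update a i (x + y)) = f (Function.update a i x) + f (Function.update a i y)
  smul : ∀ a i (c : K) x, i ∈ S →
    f (Function.update a i (c • x)) = c • f (Function.update a i x)

variable {K A}

theorem MultilinearOn.bilin {n : ℕ} {M N P : Type*} [AddCommMonoid M] [Module K M]
    [AddCommMonoid N] [Module K N] [AddCommMonoid P] [Module K P] {S T : Finset (Fin n)}
    {f : (Fin n → A) → M} {g : (Fin n → A) → N} (hf : MultilinearOn K A S f)
    (hg : MultilinearOn K A T g) (hST : Disjoint S T) (b : M →ₗ[K] N →ₗ[K] P) :
    MultilinearOn K A (S ∪ T) (fun a => b (f a) (g a)) where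
  const a i x hi := by
    rw [Finset.mem_union, not_or] at hi
    simp only [hf.const a i x hi.1, hg.const a i x hi.2]
  add a i x y hi := by
    rcases Finset.mem_union.1 hi with h | h
    · have h' : i ∉ T := Finset.disjoint_left.1 hST h
      simp [hg.const _ _ _ h', hf.add a i x y h]
    · have h' : i ∉ S := Finset.disjoint_right.1 hST h
      simp [hf.const _ _ _ h', hg.add a i x y h]
  smul a i c x hi := by
    rcases Finset.mem_union.1 hi with h | h
    · have h' : i ∉ T := Finset.disjoint_left.1 hST h
      simp [hg.const _ _ _ h', hf.smul a i c x h]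
    · have h' : i ∉ S := Finset.disjoint_right.1 hST h
      simp [hf.const _ _ _ h', hg.smul a i c x h]

theorem MultilinearOn.listProd {n : ℕ} {B : Type*} [Semiring B] [Algebra K B]
    (f : Finset (Fin n) → (Fin n → A) → B) (hf : ∀ J, MultilinearOn K A J (f J))
    (l : List (Finset (Fin n))) (hl : l.Pairwise Disjoint) :
    MultilinearOn K A (Finset.univ.filter fun i => ∃ J ∈ l, i ∈ J)
      (fun a => (l.map fun J => f J a).prod) := by
  induction l with
  | nil => constructor <;> simp
  | cons J l ih =>
    rw [List.pairwise_cons] at hl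
    have key := (hf J).bilin (ih hl.2) (by
      rw [Finset.disjoint_left]
      intro i hi hi'
      simp only [Finset.mem_filter, Finset.mem_univ, true_and] at hi'
      obtain ⟨J', hJ', hiJ'⟩ := hi'
      exact Finset.disjoint_left.1 (hl.1 J' hJ') hi hiJ') (LinearMap.mul K B)
    have hset : (Finset.univ.filter fun i => ∃ J' ∈ J :: l, i ∈ J') =
        J ∪ Finset.univ.filter fun i => ∃ J' ∈ l, i ∈ J' := by
      ext i; simp
    rw [hset]
    simpa using key

/-- A `K`-multilinear map from a function that is multilinear on all coordinates. -/
def MultilinearOn.toMultilinearMap {n : ℕ} {M : Type*} [AddCommMonoid M] [Module K M]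
    {S : Finset (Fin n)} {f : (Fin n → A) → M} (hf : MultilinearOn K A S f)
    (hS : ∀ i, i ∈ S) : MultilinearMap K (fun _ : Fin n => A) M :=
  MultilinearMap.mk' f (fun a i x y => hf.add a i x y (hS i))
    (fun a i c x => hf.smul a i c x (hS i))

variable {V : Type*} [AddCommMonoid V] [Module K V]

/-- For `J ⊆ Fin n`, the element of the tensor algebra over `V` given by the subword
`a_J = a_{j₁} ⋯ a_{j_p}`, sent to `V` by `e J`; it is the unit if `J = ∅`. -/
noncomputable def letter {n : ℕ}
    (e : ∀ J : Finset (Fin n), J.Nonempty → ((⨂[K]^J.card A) →ₗ[K] V))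
    (J : Finset (Fin n)) (a : Fin n → A) : TensorAlgebra K V :=
  if h : J.Nonempty then
    TensorAlgebra.ι K (e J h (PiTensorProduct.tprod K fun j => a (J.orderEmbOfFin rfl j)))
  else 1

theorem multilinearOn_letter {n : ℕ}
    (e : ∀ J : Finset (Fin n), J.Nonempty → ((⨂[K]^J.card A) →ₗ[K] V))
    (J : Finset (Fin n)) : MultilinearOn K A J (letter e J) := by
  by_cases h : J.Nonempty
  · have hupd : ∀ (a : Fin n → A) (j : Fin J.card) (x : A),
        (fun k => Function.update a (J.orderEmbOfFin rfl j) x (J.orderEmbOfFin rfl k)) =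
          Function.update (fun k => a (J.orderEmbOfFin rfl k)) j x := fun a j x =>
      Function.update_comp_eq_of_injective a (J.orderEmbOfFin rfl).injective j x
    have hsurj : ∀ i ∈ J, ∃ j, J.orderEmbOfFin rfl j = i := fun i hi => by
      have : i ∈ Set.range (J.orderEmbOfFin rfl) := by
        rw [Finset.range_orderEmbOfFin]; exact hi
      exact this
    constructor
    · intro a i x hi
      have : (fun k => Function.update a i x (J.orderEmbOfFin rfl k)) =
          fun k => a (J.orderEmbOfFin rfl k) := by
        funext k
        apply Function.update_of_ne
        rintro rfl
        exact hi (J.orderEmbOfFin_mem rfl k)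
      simp [letter, h, this]
    · intro a i x y hi
      obtain ⟨j, rfl⟩ := hsurj i hi
      simp only [letter, h, dite_true, hupd, MultilinearMap.map_update_add, map_add]
    · intro a i c x hi
      obtain ⟨j, rfl⟩ := hsurj i hi
      simp only [letter, h, dite_true, hupd, MultilinearMap.map_update_smul, map_smul]
  · constructor
    · intros; simp [letter, h]
    · intro a i x y hi; exact absurd ⟨i, hi⟩ h
    · intro a i c x hi; exact absurd ⟨i, hi⟩ h

/-- The term `a_S ⊗ (a_{J₁} | ⋯ | a_{J_k})` of the coproduct of `a₁ ⋯ a_n`, where `J₁, …, J_k`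
are the connected components of the complement of `S`; the map `e` turns nonempty subwords into
letters (elements of `V`). -/
noncomputable def splitTerm {n : ℕ}
    (e : ∀ J : Finset (Fin n), J.Nonempty → ((⨂[K]^J.card A) →ₗ[K] V)) (S : Finset (Fin n)) :
    (⨂[K]^n A) →ₗ[K] TensorAlgebra K V ⊗[K] TensorAlgebra K V :=
  PiTensorProduct.lift <|
    MultilinearOn.toMultilinearMap (K := K) (A := A)
      (S := S ∪ Finset.univ.filter fun i => ∃ J ∈ components S, i ∈ J)
      (f := fun a => letter e S a ⊗ₜ[K] ((components S).map fun J => letter e J a).prod)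
      ((multilinearOn_letter e S).bilin
        (MultilinearOn.listProd (letter e) (multilinearOn_letter e) _ (components_pairwise S))
        (by
          rw [Finset.disjoint_left]
          intro i hi hi'
          simp only [Finset.mem_filter, Finset.mem_univ, true_and] at hi'
          exact (exists_mem_components_iff S i).1 hi' hi)
        (TensorProduct.mk K _ _))
      (fun i => by
        by_cases hi : i ∈ S
        · exact Finset.mem_union_left _ hi
        · exact Finset.mem_union_right _ (by simpa using (exists_mem_components_iff S i).2 hi))

theorem splitTerm_tprod {n : ℕ}
    (e : ∀ J : Finset (Fin n), J.Nonempty → ((⨂[K]^J.card A) →ₗ[K] V)) (S : Finset (Fin n))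
    (a : Fin n → A) :
    splitTerm e S (PiTensorProduct.tprod K a) =
      letter e S a ⊗ₜ[K] ((components S).map fun J => letter e J a).prod := by
  simp [splitTerm, MultilinearOn.toMultilinearMap, MultilinearMap.mk']

end Words

/-! ## Half-unshuffles on a tensor algebra and half-convolutions on its dual -/

section Duals

variable {K : Type*} [Field K] {V : Type*} [AddCommMonoid V] [Module K V]

/-- The multiplicative extension `Δ(v₁ | ⋯ | v_m) = δ(v₁) ⋯ δ(v_m)`, `Δ(1) = 1 ⊗ 1`. -/
noncomputable def extendMul (δ : V →ₗ[K] TensorAlgebra K V ⊗[K] TensorAlgebra K V) :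
    TensorAlgebra K V →ₐ[K] TensorAlgebra K V ⊗[K] TensorAlgebra K V :=
  TensorAlgebra.lift K δ

/-- Auxiliary algebra morphism: `v` acts on pairs by `(p, q) ↦ (δ₀(v) q, δ(v) q)`. -/
noncomputable def extendHalfAux (δ₀ δ : V →ₗ[K] TensorAlgebra K V ⊗[K] TensorAlgebra K V) :
    TensorAlgebra K V →ₐ[K] Module.End K
      ((TensorAlgebra K V ⊗[K] TensorAlgebra K V) × (TensorAlgebra K V ⊗[K] TensorAlgebra K V)) :=
  TensorAlgebra.lift K <|
    LinearMap.mk₂ K (fun v z => (δ₀ v * z.2, δ v * z.2))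
      (fun v w z => by simp [add_mul]) (fun c v z => by simp)
      (fun v z z' => by simp [mul_add]) (fun c v z => by simp)

/-- The extension `Δ⁺(v₁ | ⋯ | v_m) = δ₀(v₁) Δ(v₂) ⋯ Δ(v_m)` for `m ≥ 1`, where `Δ` is the
multiplicative extension of `δ`; the value on the empty word is `0`. These properties are
`extendHalf_one` and `extendHalf_ι_mul` below. -/
noncomputable def extendHalf (δ₀ δ : V →ₗ[K] TensorAlgebra K V ⊗[K] TensorAlgebra K V) :
    TensorAlgebra K V →ₗ[K] TensorAlgebra K V ⊗[K] TensorAlgebra K V where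
  toFun x := (extendHalfAux δ₀ δ x (0, 1)).1
  map_add' x y := by simp
  map_smul' c x := by simp

theorem extendHalfAux_snd (δ₀ δ : V →ₗ[K] TensorAlgebra K V ⊗[K] TensorAlgebra K V)
    (x : TensorAlgebra K V)
    (z : (TensorAlgebra K V ⊗[K] TensorAlgebra K V) × (TensorAlgebra K V ⊗[K] TensorAlgebra K V)) :
    (extendHalfAux δ₀ δ x z).2 = extendMul δ x * z.2 := by
  induction x using TensorAlgebra.induction generalizing z with
  | algebraMap r => simp [Module.algebraMap_end_apply, Algebra.smul_def]
  | ι v => simp [extendHalfAux, extendMul]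
  | mul x y hx hy => rw [map_mul, map_mul, Module.End.mul_apply, hx, hy, mul_assoc]
  | add x y hx hy => simp [hx, hy, add_mul]

theorem extendHalf_one (δ₀ δ : V →ₗ[K] TensorAlgebra K V ⊗[K] TensorAlgebra K V) :
    extendHalf δ₀ δ 1 = 0 := by
  simp [extendHalf]

theorem extendHalf_ι_mul (δ₀ δ : V →ₗ[K] TensorAlgebra K V ⊗[K] TensorAlgebra K V)
    (v : V) (x : TensorAlgebra K V) :
    extendHalf δ₀ δ (TensorAlgebra.ι K v * x) = δ₀ v * extendMul δ x := by
  have h := extendHalfAux_snd δ₀ δ x (0, 1)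
  rw [mul_one] at h
  rw [← h]
  simp [extendHalf, extendHalfAux]

/-- The augmentation (counit) of the tensor algebra as a linear form: it is null on words of
positive length and the identity on scalars. -/
noncomputable def augForm (K : Type*) [Field K] (V : Type*) [AddCommMonoid V] [Module K V] :
    Module.Dual K (TensorAlgebra K V) :=
  (TensorAlgebra.algebraMapInv : TensorAlgebra K V →ₐ[K] K).toLinearMap

/-- The projection of the unital tensor algebra onto the nonunital tensor algebra, i.e. onto the
kernel of the augmentation. -/
noncomputable def posPart (K : Type*) [Field K] (V : Type*) [AddCommMonoid V] [Module K V] :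
    TensorAlgebra K V →ₗ[K] TensorAlgebra K V :=
  LinearMap.id - (Algebra.linearMap K (TensorAlgebra K V)).comp (augForm K V)

/-- `Δ_≺(x) = Δ⁺_≺(x) - x ⊗ 1` for `x` in the nonunital tensor algebra, and `Δ_≺(1) = 0`. -/
noncomputable def halfLeft (Δp : TensorAlgebra K V →ₗ[K] TensorAlgebra K V ⊗[K] TensorAlgebra K V) :
    TensorAlgebra K V →ₗ[K] TensorAlgebra K V ⊗[K] TensorAlgebra K V :=
  (Δp - (TensorProduct.mk K _ _).flip 1).comp (posPart K V)

/-- `Δ_≻(x) = Δ⁺_≻(x) - 1 ⊗ x` for `x` in the nonunital tensor algebra, and `Δ_≻(1) = 0`. -/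
noncomputable def halfRight (Δp : TensorAlgebra K V →ₗ[K] TensorAlgebra K V ⊗[K] TensorAlgebra K V) :
    TensorAlgebra K V →ₗ[K] TensorAlgebra K V ⊗[K] TensorAlgebra K V :=
  (Δp - TensorProduct.mk K _ _ 1).comp (posPart K V)

/-- The product `m_K ∘ (f ⊗ g) ∘ D` of linear forms. -/
noncomputable def convolution
    (D : TensorAlgebra K V →ₗ[K] TensorAlgebra K V ⊗[K] TensorAlgebra K V) :
    Module.Dual K (TensorAlgebra K V) →ₗ[K] Module.Dual K (TensorAlgebra K V) →ₗ[K]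
      Module.Dual K (TensorAlgebra K V) :=
  LinearMap.mk₂ K (fun f g => (LinearMap.mul' K K ∘ₗ TensorProduct.map f g) ∘ₗ D)
    (fun f f' g => by simp [TensorProduct.map_add_left, LinearMap.comp_add, LinearMap.add_comp])
    (fun c f g => by simp [TensorProduct.map_smul_left, LinearMap.comp_smul, LinearMap.smul_comp])
    (fun f g g' => by simp [TensorProduct.map_add_right, LinearMap.comp_add, LinearMap.add_comp])
    (fun c f g => by simp [TensorProduct.map_smul_right, LinearMap.comp_smul, LinearMap.smul_comp])

/-- A vector space with a distinguished element `one`, a subspace `aug` and two bilinear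
products. -/
structure HalfProducts (K : Type*) [Field K] (E : Type*) [AddCommGroup E] [Module K E] where
  one : E
  aug : Submodule K E
  prec : E →ₗ[K] E →ₗ[K] E
  succ : E →ₗ[K] E →ₗ[K] E

/-- `E = aug ⊕ K one` is the augmentation of the shuffle (dendriform) algebra
`(aug, prec, succ)` by a unit. The products `one ≺ one` and `one ≻ one` are left unspecified. -/
structure HalfProducts.IsUnitalShuffleAlgebra {E : Type*} [AddCommGroup E] [Module K E]
    (s : HalfProducts K E) : Prop where
  one_ne_zero : s.one ≠ 0
  isCompl : IsCompl s.aug (K ∙ s.one)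
  prec_mem : ∀ a ∈ s.aug, ∀ b ∈ s.aug, s.prec a b ∈ s.aug
  succ_mem : ∀ a ∈ s.aug, ∀ b ∈ s.aug, s.succ a b ∈ s.aug
  prec_prec : ∀ a ∈ s.aug, ∀ b ∈ s.aug, ∀ c ∈ s.aug,
    s.prec (s.prec a b) c = s.prec a (s.prec b c + s.succ b c)
  succ_prec : ∀ a ∈ s.aug, ∀ b ∈ s.aug, ∀ c ∈ s.aug,
    s.prec (s.succ a b) c = s.succ a (s.prec b c)
  succ_succ : ∀ a ∈ s.aug, ∀ b ∈ s.aug, ∀ c ∈ s.aug,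
    s.succ a (s.succ b c) = s.succ (s.prec a b + s.succ a b) c
  prec_one : ∀ a ∈ s.aug, s.prec a s.one = a
  one_succ : ∀ a ∈ s.aug, s.succ s.one a = a
  one_prec : ∀ a ∈ s.aug, s.prec s.one a = 0
  succ_one : ∀ a ∈ s.aug, s.succ a s.one = 0

/-- `φ` is a morphism of shuffle algebras with units: it preserves the unit, maps the augmentation
part to the augmentation part, and preserves all half-products `a ≺ b` and `a ≻ b` in which at
least one factor lies in the augmentation part (the others, such as `one ≺ one`, are not
specified in a shuffle algebra with unit). -/
structure HalfProducts.IsMorphism {E F : Type*} [AddCommGroup E] [Module K E] [AddCommGroup F]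
    [Module K F] (s : HalfProducts K E) (t : HalfProducts K F) (φ : E →ₗ[K] F) : Prop where
  map_one : φ s.one = t.one
  map_aug : ∀ a ∈ s.aug, φ a ∈ t.aug
  map_prec : ∀ a b, a ∈ s.aug ∨ b ∈ s.aug → φ (s.prec a b) = t.prec (φ a) (φ b)
  map_succ : ∀ a b, a ∈ s.aug ∨ b ∈ s.aug → φ (s.succ a b) = t.succ (φ a) (φ b)

/-- The projection `f ↦ f - f(1) e` of linear forms on the unital tensor algebra onto those that
vanish at `1`, i.e. (extending by zero) onto the linear forms on the nonunital tensor algebra. -/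
noncomputable def formPos (K : Type*) [Field K] (V : Type*) [AddCommMonoid V] [Module K V] :
    Module.Dual K (TensorAlgebra K V) →ₗ[K] Module.Dual K (TensorAlgebra K V) :=
  LinearMap.id - (Module.Dual.eval K (TensorAlgebra K V) 1).smulRight (augForm K V)

/-- The half-products on the linear forms on the unital tensor algebra over `V`, given the maps
`Δ⁺_≺` and `Δ⁺_≻`. The linear forms on the nonunital tensor algebra are those with `f(1) = 0`;
on them `f ≺ g = m_K ∘ (f ⊗ g) ∘ Δ_≺` and `f ≻ g = m_K ∘ (f ⊗ g) ∘ Δ_≻`. This is extended to all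
linear forms bilinearly by `f ≺ e = f = e ≻ f`, `e ≺ f = 0 = f ≻ e` for `f(1) = 0`, where the unit
`e` is the augmentation (and `e ≺ e = e ≻ e = 0`, an arbitrary choice that is never used). -/
noncomputable def dualProducts
    (Δl Δr : TensorAlgebra K V →ₗ[K] TensorAlgebra K V ⊗[K] TensorAlgebra K V) :
    HalfProducts K (Module.Dual K (TensorAlgebra K V)) where
  one := augForm K V
  aug := LinearMap.ker (Module.Dual.eval K (TensorAlgebra K V) 1)
  prec := (convolution (halfLeft Δl)).compl₁₂ (formPos K V) (formPos K V) +
    ((LinearMap.lsmul K _).flip.compl₁₂ (formPos K V) (Module.Dual.eval K (TensorAlgebra K V) 1))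
  succ := (convolution (halfRight Δr)).compl₁₂ (formPos K V) (formPos K V) +
    ((LinearMap.lsmul K _).compl₁₂ (Module.Dual.eval K (TensorAlgebra K V) 1) (formPos K V))

/-- On forms vanishing at `1`, `prec` and `succ` are the half-convolutions. -/
theorem dualProducts_of_mem
    (Δl Δr : TensorAlgebra K V →ₗ[K] TensorAlgebra K V ⊗[K] TensorAlgebra K V)
    {f g : Module.Dual K (TensorAlgebra K V)} (hf : f 1 = 0) (hg : g 1 = 0) :
    (dualProducts Δl Δr).prec f g = (LinearMap.mul' K K ∘ₗ TensorProduct.map f g) ∘ₗ halfLeft Δl ∧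
    (dualProducts Δl Δr).succ f g =
      (LinearMap.mul' K K ∘ₗ TensorProduct.map f g) ∘ₗ halfRight Δr := by
  simp [dualProducts, formPos, hf, hg, convolution]

end Duals

/-! ## The double tensor algebra, decorated non-crossing partitions, and the splitting map -/

section Splitting

variable (K : Type*) [Field K] (A : Type*) [Ring A] [Algebra K A]

/-- The nonunital tensor algebra `T(A) = ⨁_{n ≥ 1} A^{⊗ n}` (as a vector space). -/
abbrev TA : Type _ := DirectSum ℕ+ fun n => ⨂[K]^(n : ℕ) A

/-- Decorated non-crossing partitions `NC(A) = ⨁_{n ≥ 1} NC_n ⊗ A^{⊗ n}`. -/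
abbrev NCA : Type _ := DirectSum ℕ+ fun n => (NC (n : ℕ) →₀ K) ⊗[K] (⨂[K]^(n : ℕ) A)

/-- A condition on subsets of `Fin n`, for all `n ≥ 1`. -/
abbrev SubsetCond : Type := ∀ n : ℕ+, Finset (Fin n) → Prop

/-- No condition. -/
def anySubset : SubsetCond := fun _ _ => True

/-- The subset contains the first element. -/
def hasFirst : SubsetCond := fun n S => (⟨0, n.pos⟩ : Fin n) ∈ S

/-- The subset does not contain the first element. -/
def lacksFirst : SubsetCond := fun n S => (⟨0, n.pos⟩ : Fin n) ∉ S

/-- Words of length `|J|` as elements of `T(A)`. -/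
noncomputable def wordTA {n : ℕ} (J : Finset (Fin n)) (h : J.Nonempty) :
    (⨂[K]^J.card A) →ₗ[K] TA K A :=
  DirectSum.lof K ℕ+ (fun n => ⨂[K]^(n : ℕ) A) ⟨J.card, h.card_pos⟩

/-- Words `w` of length `|J|`, decorating the standardized restriction of `L` to `J`:
`w ↦ st(L|_J) ⊗ w`. -/
noncomputable def wordNCA {n : ℕ} (L : NC n) (J : Finset (Fin n)) (h : J.Nonempty) :
    (⨂[K]^J.card A) →ₗ[K] NCA K A :=
  DirectSum.lof K ℕ+ (fun n => (NC (n : ℕ) →₀ K) ⊗[K] (⨂[K]^(n : ℕ) A)) ⟨J.card, h.card_pos⟩ ∘ₗ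
    TensorProduct.mk K (NC J.card →₀ K) (⨂[K]^J.card A) (Finsupp.single (L.st J) 1)

open Classical in
/-- `a₁ ⋯ a_n ↦ ∑_S a_S ⊗ (a_{J₁} | ⋯ | a_{J_k})`, the sum over all `S ⊆ Fin n` satisfying `p`. -/
noncomputable def coprodTA (p : SubsetCond) :
    TA K A →ₗ[K] TensorAlgebra K (TA K A) ⊗[K] TensorAlgebra K (TA K A) :=
  DirectSum.toModule K ℕ+ _ fun n =>
    ∑ S ∈ (Finset.univ : Finset (Finset (Fin n))).filter (p n), splitTerm (wordTA K A) S

/-- The linear map `L ⊗ w ↦ f L w` out of `NC_n ⊗ A^{⊗ n}`. -/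
noncomputable def liftNC {n : ℕ} {M : Type*} [AddCommGroup M] [Module K M]
    (f : NC n → ((⨂[K]^n A) →ₗ[K] M)) : (NC n →₀ K) ⊗[K] (⨂[K]^n A) →ₗ[K] M :=
  TensorProduct.lift (Finsupp.linearCombination K f)

open Classical in
/-- `L ⊗ a₁ ⋯ a_n ↦ ∑_Q (st(Q) ⊗ a_Q) ⊗ (st(J₁) ⊗ a_{J₁} | ⋯ | st(J_k) ⊗ a_{J_k})`, the sum
over all admissible partitions `L = Q ⊔ U` such that the union of the blocks in `Q`
satisfies `p`. -/
noncomputable def coprodNCA (p : SubsetCond) :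
    NCA K A →ₗ[K] TensorAlgebra K (NCA K A) ⊗[K] TensorAlgebra K (NCA K A) :=
  DirectSum.toModule K ℕ+ _ fun n => liftNC K A fun L : NC (n : ℕ) =>
      ∑ Q ∈ (admissible L).filter (fun Q => p n (Q.biUnion id)),
        splitTerm (wordNCA K A L) (Q.biUnion id)

/-- The linear forms on the unital tensor algebra over `T(A)` with their half-convolutions. -/
noncomputable def dualTA : HalfProducts K (Module.Dual K (TensorAlgebra K (TA K A))) :=
  dualProducts (extendHalf (coprodTA K A hasFirst) (coprodTA K A anySubset))
    (extendHalf (coprodTA K A lacksFirst) (coprodTA K A anySubset))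

/-- The linear forms on the unital tensor algebra over `NC(A)` with their half-convolutions. -/
noncomputable def dualNCA : HalfProducts K (Module.Dual K (TensorAlgebra K (NCA K A))) :=
  dualProducts (extendHalf (coprodNCA K A hasFirst) (coprodNCA K A anySubset))
    (extendHalf (coprodNCA K A lacksFirst) (coprodNCA K A anySubset))

/-- The splitting map `T(A) → NC(A)`, `a₁ ⋯ a_n ↦ ∑_{L ∈ NC_n} L ⊗ (a₁ ⋯ a_n)`. -/
noncomputable def splitLetter : TA K A →ₗ[K] NCA K A :=
  DirectSum.toModule K ℕ+ _ fun n =>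
    ∑ L : NC (n : ℕ),
      DirectSum.lof K ℕ+ (fun n => (NC (n : ℕ) →₀ K) ⊗[K] (⨂[K]^(n : ℕ) A)) n ∘ₗ
        TensorProduct.mk K (NC (n : ℕ) →₀ K) (⨂[K]^(n : ℕ) A) (Finsupp.single L 1)

/-- The splitting map `Sp`, extended multiplicatively:
`Sp(A₁ | ⋯ | A_k) = Sp(A₁) | ⋯ | Sp(A_k)`. -/
noncomputable def Sp : TensorAlgebra K (TA K A) →ₐ[K] TensorAlgebra K (NCA K A) :=
  TensorAlgebra.lift K (TensorAlgebra.ι K ∘ₗ splitLetter K A)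

/-- The dual map `Sp^* f = f ∘ Sp`. -/
noncomputable def SpDual : Module.Dual K (TensorAlgebra K (NCA K A)) →ₗ[K]
    Module.Dual K (TensorAlgebra K (TA K A)) :=
  Module.Dual.transpose (Sp K A).toLinearMap

end Splitting

end SplittingProcess

/-! Because partitions are non-crossing, admissibility of a set Q of blocks of L depends only on S =
∪Q: it means that L refines the partition of [n] into S and the connected components of its
complement (`mem_admissible`). The coproduct of L ⊗ a is therefore a sum over the subsets S
compatible with L, and both ways of iterating it give one sum over chains S ⊆ S'. The left factor
carries S, the middle one S' \ S cut into pieces by S, and the right one the components of the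
complement of S'. That the cuts and the compatibility conditions agree is the content of
`relComponents_eq_filter`, `components_eq_flatMap` and `compat_chain`.

The half-coproducts only record where the first element lies. The three cases 1 ∈ S, 1 ∈ S' \ S and
1 ∉ S' are the three identities of `IsUnshuffle`, known at first for letters
(`isUnshuffle_coprodNCA`). They pass to all words because a half-coproduct treats only the first
letter specially and Δ is multiplicative. Evaluating f ⊗ g ⊗ h on them yields the three shuffle
axioms (`IsUnshuffle.isUnitalShuffleAlgebra`).

For the splitting map, giving L ∈ NC_n compatible with S is the same as giving a non-crossing
partition of S and one of each component of its complement: such pieces always glue to a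
non-crossing partition (`exists_graphOf_eq`). Summing over L then shows that Sp intertwines the
coproducts and the half-coproducts (`sum_compat_restr`), so its transpose is a morphism.

The axioms over T(A) need no second verification. Reading off the coefficient of the discrete
partition is a left inverse of the splitting map on letters, so the transpose is onto and its target
inherits the axioms from its source. -/

namespace SplittingProcess

/-! ### Terms of a sum that are switched off by a condition -/

section OnlyIf

variable {M : Type*} [Zero M] {P Q : Prop} {x y : M}

/-- The element `x` if `P` holds, and zero otherwise. -/
noncomputable def onlyIf (P : Prop) (x : M) : M := @ite M P (Classical.propDecidable P) x 0

theorem onlyIf_pos (h : P) : onlyIf P x = x := by simp [onlyIf, h]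

theorem onlyIf_neg (h : ¬ P) : onlyIf P x = 0 := by simp [onlyIf, h]

theorem onlyIf_congr (h : P ↔ Q) (hxy : x = y) : onlyIf P x = onlyIf Q y := by
  rw [h, hxy]

theorem onlyIf_and : onlyIf (P ∧ Q) x = onlyIf P (onlyIf Q x) := by
  by_cases hP : P <;> by_cases hQ : Q <;> simp [onlyIf, hP, hQ]

theorem sum_onlyIf {ι M : Type*} [AddCommMonoid M] (s : Finset ι) (P : ι → Prop)
    [DecidablePred P] (f : ι → M) :
    ∑ i ∈ s, onlyIf (P i) (f i) = ∑ i ∈ s.filter P, f i := by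
  rw [Finset.sum_filter]
  exact Finset.sum_congr rfl fun i _ => by by_cases h : P i <;> simp [onlyIf, h]

end OnlyIf

/-! ### Connected components of complements, absolute and relative to a subset -/

section Components

variable {n : ℕ}

theorem self_mem_component {S : Finset (Fin n)} {i : Fin n} (h : i ∉ S) : i ∈ component S i := by
  rw [mem_component]; simpa using h

theorem notMem_of_mem_component {S : Finset (Fin n)} {i j : Fin n} (h : j ∈ component S i) :
    j ∉ S :=
  mem_component.1 h j Finset.right_mem_uIcc

theorem mem_component_comm {S : Finset (Fin n)} {i j : Fin n} :
    j ∈ component S i ↔ i ∈ component S j := by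
  rw [mem_component, mem_component, Finset.uIcc_comm]

theorem component_eq_of_mem {S : Finset (Fin n)} {i j : Fin n} (h : j ∈ component S i) :
    component S j = component S i := by
  ext k
  constructor
  · intro hk
    exact component_trans h (mem_component_comm.1 hk)
  · intro hk
    exact component_trans (mem_component_comm.1 h) (mem_component_comm.1 hk)

theorem mem_components_iff {S J : Finset (Fin n)} :
    J ∈ components S ↔ ∃ i ∉ S, J = component S i := by
  constructor
  · intro h
    simp only [components, List.mem_map, Finset.mem_sort] at h
    obtain ⟨i, hi, rfl⟩ := h
    simp only [leaders, Finset.mem_filter, Finset.mem_univ, true_and] at hi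
    exact ⟨i, hi.1, rfl⟩
  · rintro ⟨i, hi, rfl⟩
    obtain ⟨J, hJ, hiJ⟩ := (exists_mem_components_iff S i).2 hi
    have hJ' := hJ
    simp only [components, List.mem_map, Finset.mem_sort] at hJ'
    obtain ⟨k, -, rfl⟩ := hJ'
    rwa [component_eq_of_mem hiJ]

theorem nonempty_of_mem_components {S J : Finset (Fin n)} (h : J ∈ components S) :
    J.Nonempty := by
  obtain ⟨i, hi, rfl⟩ := mem_components_iff.1 h
  exact ⟨i, self_mem_component hi⟩

/-- Every element of `B` precedes every element of `C`. -/
def Before (B C : Finset (Fin n)) : Prop := ∀ b ∈ B, ∀ c ∈ C, b < c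

theorem components_pairwise_before (S : Finset (Fin n)) :
    (components S).Pairwise Before := by
  unfold components
  rw [List.pairwise_map]
  refine ((leaders S).sortedLT_sort).pairwise.imp_of_mem ?_
  intro i j hi hj hij a ha b hb
  rw [Finset.mem_sort] at hi hj
  simp only [leaders, Finset.mem_filter, Finset.mem_univ, true_and] at hi hj
  -- If b ≤ a, then i < j ≤ b ≤ a puts j in the component of i, against the minimality of the leader
  -- j in its own component.
  by_contra! hba
  have hia := hi.2 a ha
  have hjb := hj.2 b hb
  have hji : j ∈ component S i := by
    rw [mem_component] at ha ⊢
    intro k hk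
    refine ha k ?_
    rw [Finset.uIcc_of_le hij.le] at hk
    rw [Finset.uIcc_of_le hia]
    simp only [Finset.mem_Icc] at hk ⊢
    exact ⟨hk.1, hk.2.trans (hjb.trans hba)⟩
  exact absurd (hj.2 i (mem_component_comm.1 hji)) (not_le.2 hij)

/-- `Before` is strict and antisymmetric on non-empty sets, so the order of such a list is forced by
its members. Identities between lists of components thereby reduce to identities between sets of
components. -/
theorem eq_of_pairwise_before {l l' : List (Finset (Fin n))} (h : l.Pairwise Before)
    (h' : l'.Pairwise Before) (hne : ∀ J ∈ l, J.Nonempty)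
    (hmem : ∀ J, J ∈ l ↔ J ∈ l') : l = l' := by
  have nodup : ∀ l : List (Finset (Fin n)), l.Pairwise Before → (∀ J ∈ l, J.Nonempty) →
      l.Nodup := by
    intro l hl hne
    refine hl.imp_of_mem ?_
    rintro J J' hJ - hb rfl
    obtain ⟨x, hx⟩ := hne J hJ
    exact lt_irrefl _ (hb x hx x hx)
  have hne' : ∀ J ∈ l', J.Nonempty := fun J hJ => hne J ((hmem J).2 hJ)
  refine List.Perm.eq_of_pairwise ?_ h h' ((List.perm_ext_iff_of_nodup (nodup l h hne)
    (nodup l' h' hne')).2 hmem)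
  intro B C hB hC hBC hCB
  obtain ⟨x, hx⟩ := hne B hB
  obtain ⟨y, hy⟩ := hne' C hC
  exact absurd (hBC x hx y hy) (hCB y hy x hx).asymm

/-- The inclusion of `Fin U.card` in `Fin n` as the subset `U`. -/
abbrev incl (U : Finset (Fin n)) : Fin U.card ↪o Fin n := U.orderEmbOfFin rfl

theorem exists_incl_eq {U : Finset (Fin n)} {i : Fin n} (hi : i ∈ U) : ∃ j, incl U j = i := by
  have : i ∈ Set.range (incl U) := by
    rw [Finset.range_orderEmbOfFin]; exact hi
  exact this

theorem incl_mem (U : Finset (Fin n)) (j : Fin U.card) : incl U j ∈ U :=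
  U.orderEmbOfFin_mem rfl j

theorem mem_pullBlock {U T : Finset (Fin n)} {j : Fin U.card} :
    j ∈ pullBlock U T ↔ incl U j ∈ T := by
  simp [pullBlock]

theorem map_pullBlock {U T : Finset (Fin n)} :
    (pullBlock U T).map (incl U).toEmbedding = U ∩ T := by
  ext i
  simp only [Finset.mem_map, mem_pullBlock, Finset.mem_inter]
  constructor
  · rintro ⟨j, hj, rfl⟩
    exact ⟨incl_mem U j, hj⟩
  · rintro ⟨hU, hT⟩
    obtain ⟨j, rfl⟩ := exists_incl_eq hU
    exact ⟨j, hT, rfl⟩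

theorem pullBlock_map {U : Finset (Fin n)} (T : Finset (Fin U.card)) :
    pullBlock U (T.map (incl U).toEmbedding) = T := by
  ext i
  simp [mem_pullBlock]

/-- The elements of `U` that lie in the same connected component as `i` of the complement
of `T` relative to `U`. -/
def relComponent (U T : Finset (Fin n)) (i : Fin n) : Finset (Fin n) :=
  U.filter fun j => ∀ k ∈ Finset.uIcc i j, k ∈ U → k ∉ T

theorem mem_relComponent {U T : Finset (Fin n)} {i j : Fin n} :
    j ∈ relComponent U T i ↔ j ∈ U ∧ ∀ k ∈ Finset.uIcc i j, k ∈ U → k ∉ T := by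
  simp [relComponent]

/-- The connected components of the complement of `T` relative to `U`. -/
def relComponents (U T : Finset (Fin n)) : List (Finset (Fin n)) :=
  (components (pullBlock U T)).map fun C => C.map (incl U).toEmbedding

theorem incl_mem_uIcc {U : Finset (Fin n)} {i j k : Fin U.card} :
    incl U k ∈ Finset.uIcc (incl U i) (incl U j) ↔ k ∈ Finset.uIcc i j := by
  simp only [Finset.mem_uIcc', OrderEmbedding.le_iff_le]

theorem mem_component_pullBlock {U T : Finset (Fin n)} {i j : Fin U.card} :
    j ∈ component (pullBlock U T) i ↔ ∀ k ∈ Finset.uIcc (incl U i) (incl U j), k ∈ U → k ∉ T := by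
  rw [mem_component]
  constructor
  · intro h k hk hkU
    obtain ⟨k, rfl⟩ := exists_incl_eq hkU
    exact fun hT => h k (incl_mem_uIcc.1 hk) (mem_pullBlock.2 hT)
  · intro h k hk hT
    exact h _ (incl_mem_uIcc.2 hk) (incl_mem U k) (mem_pullBlock.1 hT)

theorem map_component_pullBlock {U T : Finset (Fin n)} (i : Fin U.card) :
    (component (pullBlock U T) i).map (incl U).toEmbedding = relComponent U T (incl U i) := by
  ext j
  rw [mem_relComponent, Finset.mem_map]
  constructor
  · rintro ⟨j, hj, rfl⟩
    exact ⟨incl_mem U j, mem_component_pullBlock.1 hj⟩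
  · rintro ⟨hU, h⟩
    obtain ⟨j, rfl⟩ := exists_incl_eq hU
    exact ⟨j, mem_component_pullBlock.2 h, rfl⟩

theorem mem_relComponents_iff {U T J : Finset (Fin n)} :
    J ∈ relComponents U T ↔ ∃ i ∈ U, i ∉ T ∧ J = relComponent U T i := by
  simp only [relComponents, List.mem_map, mem_components_iff]
  constructor
  · rintro ⟨C, ⟨i, hi, rfl⟩, rfl⟩
    exact ⟨incl U i, incl_mem U i, fun h => hi (mem_pullBlock.2 h), map_component_pullBlock i⟩
  · rintro ⟨i, hi, hiT, rfl⟩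
    obtain ⟨i, rfl⟩ := exists_incl_eq hi
    exact ⟨_, ⟨i, fun h => hiT (mem_pullBlock.1 h), rfl⟩, map_component_pullBlock i⟩

theorem self_mem_relComponent {U T : Finset (Fin n)} {i : Fin n} (hi : i ∈ U) (hT : i ∉ T) :
    i ∈ relComponent U T i := by
  rw [mem_relComponent]; simpa [hi] using hT

theorem subset_of_mem_relComponents {U T J : Finset (Fin n)} (h : J ∈ relComponents U T) :
    J ⊆ U := by
  obtain ⟨i, -, -, rfl⟩ := mem_relComponents_iff.1 h
  exact Finset.filter_subset _ _

theorem nonempty_of_mem_relComponents {U T J : Finset (Fin n)} (h : J ∈ relComponents U T) :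
    J.Nonempty := by
  obtain ⟨i, hi, hT, rfl⟩ := mem_relComponents_iff.1 h
  exact ⟨i, self_mem_relComponent hi hT⟩

theorem relComponents_pairwise_before (U T : Finset (Fin n)) :
    (relComponents U T).Pairwise Before := by
  unfold relComponents
  rw [List.pairwise_map]
  refine (components_pairwise_before _).imp ?_
  intro B C h b hb c hc
  simp only [Finset.mem_map] at hb hc
  obtain ⟨b, hb, rfl⟩ := hb
  obtain ⟨c, hc, rfl⟩ := hc
  exact (incl U).strictMono (h b hb c hc)

theorem relComponents_inter (U T : Finset (Fin n)) :
    relComponents U (T ∩ U) = relComponents U T := by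
  have : pullBlock U (T ∩ U) = pullBlock U T := by
    ext j
    simp [mem_pullBlock]
  rw [relComponents, this, relComponents]

/-- Every point of S already lies in S', so two points of S' are separated by S inside S' exactly
when they are separated by S in the whole interval. A component of the complement of S may miss S',
hence the filter. This describes the middle factor of the iterated coproduct. -/
theorem relComponents_eq_filter {S S' : Finset (Fin n)} (h : S ⊆ S') :
    relComponents S' S =
      ((components S).map fun J => S' ∩ J).filter fun J => J.Nonempty := by
  refine eq_of_pairwise_before (relComponents_pairwise_before _ _) ?_
    (fun J => nonempty_of_mem_relComponents) ?_
  · refine List.Pairwise.filter _ ?_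
    rw [List.pairwise_map]
    refine (components_pairwise_before S).imp ?_
    intro B C hBC b hb c hc
    exact hBC b (Finset.mem_inter.1 hb).2 c (Finset.mem_inter.1 hc).2
  · have key : ∀ i, relComponent S' S i = S' ∩ component S i := by
      intro i
      ext j
      simp only [mem_relComponent, Finset.mem_inter, mem_component]
      exact and_congr_right fun _ => forall₂_congr fun k _ =>
        ⟨fun hk hkS => hk (h hkS) hkS, fun hk _ => hk⟩
    intro J
    simp only [mem_relComponents_iff, List.mem_filter, List.mem_map, mem_components_iff,
      decide_eq_true_eq]
    constructor
    · rintro ⟨i, hi, hiS, rfl⟩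
      exact ⟨⟨_, ⟨i, hiS, rfl⟩, (key i).symm⟩, i, self_mem_relComponent hi hiS⟩
    · rintro ⟨⟨_, ⟨i, hi, rfl⟩, rfl⟩, j, hj⟩
      rw [Finset.mem_inter] at hj
      refine ⟨j, hj.1, notMem_of_mem_component hj.2, ?_⟩
      rw [key, component_eq_of_mem hj.2]

/-- Enlarging S to S' only adds separators, so each component for S' lies in a single component J
for S and is a component of J relative to S'. This describes the right factor of the iterated
coproduct. -/
theorem components_eq_flatMap {S S' : Finset (Fin n)} (h : S ⊆ S') :
    components S' = (components S).flatMap fun J => relComponents J S' := by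
  refine eq_of_pairwise_before (components_pairwise_before _) ?_
    (fun J => nonempty_of_mem_components) ?_
  · rw [List.pairwise_flatMap]
    refine ⟨fun J _ => relComponents_pairwise_before J S', ?_⟩
    refine (components_pairwise_before S).imp ?_
    intro B C hBC b hb c hc x hx y hy
    exact hBC x (subset_of_mem_relComponents hb hx) y (subset_of_mem_relComponents hc hy)
  · have key : ∀ i, relComponent (component S i) S' i = component S' i := by
      intro i
      ext j
      simp only [mem_relComponent, mem_component]
      constructor
      · rintro ⟨h₁, h₂⟩ k hk
        refine h₂ k hk fun l hl => h₁ l ?_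
        exact Finset.uIcc_subset_uIcc Finset.left_mem_uIcc hk hl
      · intro h'
        exact ⟨fun k hk hkS => h' k hk (h hkS), fun k hk _ => h' k hk⟩
    have key' : ∀ i j, j ∈ component S i →
        relComponent (component S i) S' j = component S' j := by
      intro i j hj
      rw [← component_eq_of_mem hj, key]
    intro J
    simp only [List.mem_flatMap, mem_relComponents_iff, mem_components_iff]
    constructor
    · rintro ⟨i, hi, rfl⟩
      have hiS : i ∉ S := fun hiS => hi (h hiS)
      exact ⟨_, ⟨i, hiS, rfl⟩, i, self_mem_component hiS, hi, (key i).symm⟩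
    · rintro ⟨_, ⟨i, hi, rfl⟩, j, hj, hjS, rfl⟩
      exact ⟨j, hjS, key' i j hj⟩

end Components

/-! ### Admissible sets of blocks as compatible subsets -/

section Compatibility

variable {n : ℕ}

/-- The trace on `U` of the set partition `L` refines the partition of `U` into `T` and the
connected components of the complement of `T` relative to `U`. -/
def RelCompat (L : NC n) (U T : Finset (Fin n)) : Prop :=
  ∀ p ∈ U, ∀ q ∈ U, SameBlock L.1 p q →
    (p ∈ T ∧ q ∈ T) ∨ ∀ k ∈ Finset.uIcc p q, k ∈ U → k ∉ T

/-- The set partition `L` refines the partition into `S` and the connected components of the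
complement of `S`. -/
def Compat (L : NC n) (S : Finset (Fin n)) : Prop :=
  ∀ p q, SameBlock L.1 p q → (p ∈ S ∧ q ∈ S) ∨ q ∈ component S p

theorem compat_st_iff {L : NC n} {U T : Finset (Fin n)} :
    Compat (L.st U) (pullBlock U T) ↔ RelCompat L U T := by
  constructor
  · intro h p hp q hq hpq
    obtain ⟨p, rfl⟩ := exists_incl_eq hp
    obtain ⟨q, rfl⟩ := exists_incl_eq hq
    simpa only [mem_pullBlock, mem_component_pullBlock] using
      h p q ((sameBlock_stdRestrict L.1 U p q).2 hpq)
  · intro h p q hpq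
    simpa only [mem_pullBlock, mem_component_pullBlock] using
      h _ (incl_mem U p) _ (incl_mem U q) ((sameBlock_stdRestrict L.1 U p q).1 hpq)

theorem relCompat_inter {L : NC n} {U T : Finset (Fin n)} :
    RelCompat L U (T ∩ U) ↔ RelCompat L U T := by
  refine forall₂_congr fun p hp => forall₂_congr fun q hq => imp_congr_right fun _ => ?_
  refine or_congr (by simp [hp, hq]) (forall₂_congr fun k _ => forall_congr' fun hk => ?_)
  simp [hk]

/-- Both sides say that L refines the partition into S, the pieces of S' \ S cut out by S, and the
components of the complement of S'. The two orders of splitting therefore allow the same chains S ⊆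
S', which is the combinatorial core of coassociativity. -/
theorem compat_chain {L : NC n} {S S' : Finset (Fin n)} (h : S ⊆ S') :
    Compat L S' ∧ RelCompat L S' S ↔
      Compat L S ∧ ∀ J ∈ components S, RelCompat L J S' := by
  have hsub : ∀ {p q k : Fin n}, k ∈ Finset.uIcc p q → Finset.uIcc p k ⊆ Finset.uIcc p q :=
    fun hk => Finset.uIcc_subset_uIcc Finset.left_mem_uIcc hk
  constructor
  · rintro ⟨h₁, h₂⟩
    refine ⟨fun p q hpq => ?_, fun J _ p _ q _ hpq => ?_⟩
    · rcases h₁ p q hpq with ⟨hp, hq⟩ | hq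
      · rcases h₂ p hp q hq hpq with h₃ | h₃
        · exact Or.inl h₃
        · refine Or.inr (mem_component.2 fun k hk hkS => h₃ k hk (h hkS) hkS)
      · exact Or.inr (mem_component.2 fun k hk hkS => mem_component.1 hq k hk (h hkS))
    · rcases h₁ p q hpq with h₃ | hq
      · exact Or.inl h₃
      · exact Or.inr fun k hk _ => mem_component.1 hq k hk
  · rintro ⟨h₁, h₂⟩
    refine ⟨fun p q hpq => ?_, fun p _ q _ hpq => ?_⟩
    · rcases h₁ p q hpq with ⟨hp, hq⟩ | hq
      · exact Or.inl ⟨h hp, h hq⟩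
      · have hp : p ∉ S := mem_component.1 hq p Finset.left_mem_uIcc
        rcases h₂ _ (mem_components_iff.2 ⟨p, hp, rfl⟩) p (self_mem_component hp) q hq hpq
          with h₃ | h₃
        · exact Or.inl h₃
        · refine Or.inr (mem_component.2 fun k hk => h₃ k hk ?_)
          exact mem_component.2 fun l hl => mem_component.1 hq l (hsub hk hl)
    · rcases h₁ p q hpq with h₃ | hq
      · exact Or.inl h₃
      · exact Or.inr fun k hk _ => mem_component.1 hq k hk

theorem eq_of_sameBlock {L : Finpartition (Finset.univ : Finset (Fin n))} {B : Finset (Fin n)}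
    (hB : B ∈ L.parts) {p q : Fin n} (hp : p ∈ B) (hpq : SameBlock L p q) : q ∈ B := by
  obtain ⟨C, hC, hpC, hqC⟩ := hpq
  rwa [L.eq_of_mem_parts hB hC hp hpC]

theorem biUnion_subset_iff {L : NC n} {Q : Finset (Finset (Fin n))} (hQ : Q ⊆ L.1.parts)
    {B : Finset (Fin n)} (hB : B ∈ L.1.parts) {p : Fin n} (hp : p ∈ B) :
    p ∈ Q.biUnion id ↔ B ∈ Q := by
  simp only [Finset.mem_biUnion, id]
  constructor
  · rintro ⟨C, hC, hpC⟩
    rwa [L.1.eq_of_mem_parts hB (hQ hC) hp hpC]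
  · exact fun h => ⟨B, h, hp⟩

/-- If a block C outside Q is separated by a point k of a block B in Q, then k lies strictly between
two points of C, and non-crossingness forces all of B between points of C. So B is nested in C,
which admissibility forbids. Conversely, a block of Q nested in C separates two points of C. -/
theorem mem_admissible {L : NC n} {Q : Finset (Finset (Fin n))} :
    Q ∈ admissible L ↔ Q ⊆ L.1.parts ∧ Compat L (Q.biUnion id) := by
  simp only [admissible, Finset.mem_filter, Finset.mem_powerset, Finset.mem_sdiff, and_imp]
  refine and_congr_right fun hQ => ?_
  constructor
  · intro h p q hpq
    by_cases hp : p ∈ Q.biUnion id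
    · left
      refine ⟨hp, ?_⟩
      obtain ⟨B, hB, hpB, hqB⟩ := hpq
      rw [biUnion_subset_iff hQ hB hpB] at hp
      rwa [biUnion_subset_iff hQ hB hqB]
    · right
      obtain ⟨C, hC, hpC, hqC⟩ := hpq
      have hCQ : C ∉ Q := by rwa [biUnion_subset_iff hQ hC hpC] at hp
      rw [mem_component]
      intro k hk hkQ
      obtain ⟨B, hB, hkB⟩ := L.1.exists_mem (Finset.mem_univ k)
      rw [biUnion_subset_iff hQ hB hkB] at hkQ
      refine h B hkQ C hC hCQ ?_
      have hdisj : ∀ x ∈ B, x ∉ C := fun x hxB hxC =>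
        hCQ (by rwa [← L.1.eq_of_mem_parts hB hC hxB hxC])
      obtain ⟨c, d, hc, hd, hck, hkd⟩ : ∃ c d, c ∈ C ∧ d ∈ C ∧ c < k ∧ k < d := by
        have hkp : k ≠ p := fun e => hdisj k hkB (e ▸ hpC)
        have hkq : k ≠ q := fun e => hdisj k hkB (e ▸ hqC)
        rcases Finset.mem_uIcc'.1 hk with hk | hk
        · exact ⟨p, q, hpC, hqC, lt_of_le_of_ne hk.1 hkp.symm, lt_of_le_of_ne hk.2 hkq⟩
        · exact ⟨q, p, hqC, hpC, lt_of_le_of_ne hk.1 hkq.symm, lt_of_le_of_ne hk.2 hkp⟩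
      have hnot : ∀ x ∈ C, ∀ y ∈ B, ¬ SameBlock L.1 x y := fun x hx y hy hxy =>
        hdisj y hy (eq_of_sameBlock hC hx hxy)
      have hnot' : ∀ x ∈ C, ∀ y ∈ B, ¬ SameBlock L.1 y x := fun x hx y hy hxy =>
        hdisj x (eq_of_sameBlock hB hy hxy) hx
      intro m hm
      constructor
      · by_contra! hlt
        have hmc : m < c := lt_of_le_of_ne (hlt c hc) fun e => hdisj m hm (e ▸ hc)
        -- A point m of B to the left of c would give the crossing m < c < k < d, with m, k in B and
        -- c, d in C. The mirror image excludes points of B to the right of d.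
        exact L.2 ⟨m, c, k, d, hmc, hck, hkd, ⟨B, hB, hm, hkB⟩, hnot' c hc k hkB,
          ⟨C, hC, hc, hd⟩⟩
      · by_contra! hlt
        have hmd : d < m := lt_of_le_of_ne (hlt d hd) fun e => hdisj m hm (e ▸ hd)
        exact L.2 ⟨c, k, d, m, hck, hkd, hmd, ⟨C, hC, hc, hd⟩, hnot d hd k hkB,
          ⟨B, hB, hkB, hm⟩⟩
  · intro h B hB C hC hCQ hBC
    obtain ⟨m, hm⟩ := L.1.nonempty_of_mem_parts (hQ hB)
    obtain ⟨⟨x, hx, hxm⟩, y, hy, hmy⟩ := hBC m hm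
    rcases h x y ⟨C, hC, hx, hy⟩ with ⟨hxQ, -⟩ | hy'
    · exact hCQ ((biUnion_subset_iff hQ hC hx).1 hxQ)
    · refine mem_component.1 hy' m ?_ ((biUnion_subset_iff hQ (hQ hB) hm).2 hB)
      rw [Finset.uIcc_of_le (hxm.trans hmy).le]
      exact Finset.mem_Icc.2 ⟨hxm.le, hmy.le⟩

open Classical in
-- Q is recovered from its union S as the set of blocks contained in S, so the sum may run over
-- subsets instead of sets of blocks.
theorem sum_admissible {M : Type*} [AddCommMonoid M] (L : NC n) (p : Finset (Fin n) → Prop)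
    (f : Finset (Fin n) → M) :
    ∑ Q ∈ (admissible L).filter (fun Q => p (Q.biUnion id)), f (Q.biUnion id) =
      ∑ S : Finset (Fin n), onlyIf (Compat L S ∧ p S) (f S) := by
  rw [sum_onlyIf]
  refine Finset.sum_bij (fun Q _ => Q.biUnion id) ?_ ?_ ?_ (fun _ _ => rfl)
  · intro Q hQ
    rw [Finset.mem_filter, mem_admissible] at hQ
    simpa using ⟨hQ.1.2, hQ.2⟩
  · intro Q hQ Q' hQ' h
    rw [Finset.mem_filter, mem_admissible] at hQ hQ'
    have aux : ∀ {Q Q' : Finset (Finset (Fin n))}, Q ⊆ L.1.parts → Q' ⊆ L.1.parts →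
        Q.biUnion id = Q'.biUnion id → Q ⊆ Q' := by
      intro Q Q' hQ hQ' h B hB
      obtain ⟨m, hm⟩ := L.1.nonempty_of_mem_parts (hQ hB)
      rw [← biUnion_subset_iff hQ' (hQ hB) hm, ← h]
      exact (biUnion_subset_iff hQ (hQ hB) hm).2 hB
    exact (aux hQ.1.1 hQ'.1.1 h).antisymm (aux hQ'.1.1 hQ.1.1 h.symm)
  · intro S hS
    simp only [Finset.mem_filter, Finset.mem_univ, true_and] at hS
    have hU : (L.1.parts.filter fun B => B ⊆ S).biUnion id = S := by
      ext x
      simp only [Finset.mem_biUnion, Finset.mem_filter, id]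
      constructor
      · rintro ⟨B, ⟨-, hBS⟩, hx⟩
        exact hBS hx
      · intro hx
        obtain ⟨B, hB, hxB⟩ := L.1.exists_mem (Finset.mem_univ x)
        refine ⟨B, ⟨hB, fun y hy => ?_⟩, hxB⟩
        -- A block meeting S stays in S, since components of the complement avoid S.
        rcases hS.1 x y ⟨B, hB, hxB, hy⟩ with h | h
        · exact h.2
        · exact absurd hx (mem_component.1 h x Finset.left_mem_uIcc)
    refine ⟨L.1.parts.filter fun B => B ⊆ S, ?_, hU⟩
    rw [Finset.mem_filter, mem_admissible, hU]
    exact ⟨⟨Finset.filter_subset _ _, hS.1⟩, hS.2⟩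

theorem sameBlock_iff_mem_part {L : Finpartition (Finset.univ : Finset (Fin n))} {p q : Fin n} :
    SameBlock L p q ↔ q ∈ L.part p := by
  constructor
  · intro h
    exact eq_of_sameBlock (L.part_mem.2 (Finset.mem_univ p)) (L.mem_part (Finset.mem_univ p)) h
  · intro h
    exact ⟨L.part p, L.part_mem.2 (Finset.mem_univ p), L.mem_part (Finset.mem_univ p), h⟩

theorem NC.ext_sameBlock {L M : NC n} (h : ∀ p q, SameBlock L.1 p q ↔ SameBlock M.1 p q) :
    L = M := by
  have hpart : ∀ p, L.1.part p = M.1.part p := fun p => by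
    ext q
    rw [← sameBlock_iff_mem_part, h, sameBlock_iff_mem_part]
  have aux : ∀ {L M : NC n}, (∀ p, L.1.part p = M.1.part p) → L.1.parts ⊆ M.1.parts := by
    intro L M h B hB
    obtain ⟨m, hm⟩ := L.1.nonempty_of_mem_parts hB
    rw [← L.1.part_eq_of_mem hB hm, h]
    exact M.1.part_mem.2 (Finset.mem_univ m)
  exact Subtype.ext (Finpartition.ext ((aux hpart).antisymm (aux fun p => (hpart p).symm)))

end Compatibility

/-! ### From identities on letters to shuffle algebras of linear forms -/

section Abstract

variable {K : Type*} [Field K] {V : Type*} [AddCommMonoid V] [Module K V]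

/-- The unit and the products of a letter with an arbitrary element span the tensor algebra. The
induction carries a right factor y along, so that a product is handled one factor at a time. -/
theorem tensorAlgebra_linearMap_ext {M : Type*} [AddCommMonoid M] [Module K M]
    {F G : TensorAlgebra K V →ₗ[K] M} (h₁ : F 1 = G 1)
    (h : ∀ v x, F (TensorAlgebra.ι K v * x) = G (TensorAlgebra.ι K v * x)) : F = G := by
  have key : ∀ x y, F y = G y → F (x * y) = G (x * y) := by
    intro x
    induction x using TensorAlgebra.induction with
    | algebraMap r => intro y hy; rw [← Algebra.smul_def, map_smul, map_smul, hy]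
    | ι v => intro y _; exact h v y
    | mul x y hx hy => intro z hz; rw [mul_assoc]; exact hx _ (hy _ hz)
    | add x y hx hy => intro z hz; rw [add_mul, map_add, map_add, hx _ hz, hy _ hz]
  ext x
  simpa using key x 1 h₁

theorem augForm_one : augForm K V 1 = 1 := by simp [augForm]

theorem augForm_ι_mul (v : V) (x : TensorAlgebra K V) :
    augForm K V (TensorAlgebra.ι K v * x) = 0 := by
  simp [augForm, TensorAlgebra.algebraMapInv]

theorem extendMul_ι (δ : V →ₗ[K] TensorAlgebra K V ⊗[K] TensorAlgebra K V) (v : V) :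
    extendMul δ (TensorAlgebra.ι K v) = δ v := by
  simp [extendMul]

theorem extendHalf_ι (δ₀ δ : V →ₗ[K] TensorAlgebra K V ⊗[K] TensorAlgebra K V) (v : V) :
    extendHalf δ₀ δ (TensorAlgebra.ι K v) = δ₀ v := by
  simpa using extendHalf_ι_mul δ₀ δ v 1

theorem extendHalf_ι_mul_mul (δ₀ δ : V →ₗ[K] TensorAlgebra K V ⊗[K] TensorAlgebra K V)
    (v : V) (x y : TensorAlgebra K V) :
    extendHalf δ₀ δ (TensorAlgebra.ι K v * x * y) =
      extendHalf δ₀ δ (TensorAlgebra.ι K v * x) * extendMul δ y := by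
  rw [mul_assoc, extendHalf_ι_mul, extendHalf_ι_mul, map_mul, mul_assoc]

/-- On a non-empty word only the first factor is split into two halves. On the empty word both
halves vanish while Δ(1) = 1 ⊗ 1, which accounts for the augmentation term. -/
theorem extendMul_eq_add {δl δr δ : V →ₗ[K] TensorAlgebra K V ⊗[K] TensorAlgebra K V}
    (hδ : ∀ v, δ v = δl v + δr v) (x : TensorAlgebra K V) :
    extendMul δ x = extendHalf δl δ x + extendHalf δr δ x + augForm K V x • 1 := by
  have : (extendMul δ).toLinearMap =
      extendHalf δl δ + extendHalf δr δ + (augForm K V).smulRight 1 := by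
    refine tensorAlgebra_linearMap_ext ?_ fun v x => ?_
    · simp [extendHalf_one, augForm_one]
    · simp [extendHalf_ι_mul, augForm_ι_mul, extendMul_ι, hδ, add_mul]
  exact LinearMap.congr_fun this x

variable (K V) in
/-- The span of the tensors whose left factor is a letter. -/
def leftLetters : Submodule K (TensorAlgebra K V ⊗[K] TensorAlgebra K V) :=
  Submodule.span K {t | ∃ (u : V) (z : TensorAlgebra K V), t = TensorAlgebra.ι K u ⊗ₜ z}

variable (K V) in
/-- The span of the tensors whose right factor is a non-empty word. -/
def rightWords : Submodule K (TensorAlgebra K V ⊗[K] TensorAlgebra K V) :=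
  Submodule.span K {t | ∃ (z : TensorAlgebra K V) (u : V) (y : TensorAlgebra K V),
    t = z ⊗ₜ (TensorAlgebra.ι K u * y)}

/-- A half-coproduct of a product is the half-coproduct of the first factor times Δ of the rest as
soon as the first factor begins with a letter. Membership in `leftLetters` guarantees this for the
left tensor factor; `rightWords` plays the same role on the right in `lTensor_extendHalf_mul`. -/
theorem rTensor_extendHalf_mul (δ₀ δ : V →ₗ[K] TensorAlgebra K V ⊗[K] TensorAlgebra K V)
    {t : TensorAlgebra K V ⊗[K] TensorAlgebra K V} (ht : t ∈ leftLetters K V)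
    (s : TensorAlgebra K V ⊗[K] TensorAlgebra K V) :
    (extendHalf δ₀ δ).rTensor (TensorAlgebra K V) (t * s) =
      (extendHalf δ₀ δ).rTensor (TensorAlgebra K V) t *
        Algebra.TensorProduct.map (extendMul δ) (AlgHom.id K _) s := by
  induction ht using Submodule.span_induction with
  | mem t ht =>
    obtain ⟨u, z, rfl⟩ := ht
    induction s using TensorProduct.induction_on with
    | zero => simp
    | tmul x y =>
      simp [Algebra.TensorProduct.tmul_mul_tmul, extendHalf_ι_mul, extendHalf_ι]
    | add x y hx hy => rw [mul_add, map_add, hx, hy, map_add, mul_add]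
  | zero => simp
  | add x y _ _ hx hy => rw [add_mul, map_add, hx, hy, map_add, add_mul]
  | smul c x _ hx => rw [smul_mul_assoc, map_smul, hx, map_smul, smul_mul_assoc]

theorem lTensor_extendHalf_mul (δ₀ δ : V →ₗ[K] TensorAlgebra K V ⊗[K] TensorAlgebra K V)
    {t : TensorAlgebra K V ⊗[K] TensorAlgebra K V} (ht : t ∈ rightWords K V)
    (s : TensorAlgebra K V ⊗[K] TensorAlgebra K V) :
    (extendHalf δ₀ δ).lTensor (TensorAlgebra K V) (t * s) =
      (extendHalf δ₀ δ).lTensor (TensorAlgebra K V) t *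
        Algebra.TensorProduct.map (AlgHom.id K _) (extendMul δ) s := by
  induction ht using Submodule.span_induction with
  | mem t ht =>
    obtain ⟨z, u, w, rfl⟩ := ht
    induction s using TensorProduct.induction_on with
    | zero => simp
    | tmul x y =>
      simp [Algebra.TensorProduct.tmul_mul_tmul, extendHalf_ι_mul_mul]
    | add x y hx hy => rw [mul_add, map_add, hx, hy, map_add, mul_add]
  | zero => simp
  | add x y _ _ hx hy => rw [add_mul, map_add, hx, hy, map_add, add_mul]
  | smul c x _ hx => rw [smul_mul_assoc, map_smul, hx, map_smul, smul_mul_assoc]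

theorem rTensor_extendMul {δl δr δ : V →ₗ[K] TensorAlgebra K V ⊗[K] TensorAlgebra K V}
    (hδ : ∀ v, δ v = δl v + δr v)
    {t : TensorAlgebra K V ⊗[K] TensorAlgebra K V} (ht : t ∈ leftLetters K V) :
    (extendMul δ).toLinearMap.rTensor (TensorAlgebra K V) t =
      (extendHalf δl δ).rTensor (TensorAlgebra K V) t +
        (extendHalf δr δ).rTensor (TensorAlgebra K V) t := by
  induction ht using Submodule.span_induction with
  | mem t ht =>
    obtain ⟨u, z, rfl⟩ := ht
    simp [extendMul_ι, extendHalf_ι, hδ, TensorProduct.add_tmul]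
  | zero => simp
  | add x y _ _ hx hy => rw [map_add, hx, hy, map_add, map_add]; abel
  | smul c x _ hx => rw [map_smul, hx, map_smul, map_smul, smul_add]

theorem lTensor_extendMul {δl δr δ : V →ₗ[K] TensorAlgebra K V ⊗[K] TensorAlgebra K V}
    (hδ : ∀ v, δ v = δl v + δr v)
    {t : TensorAlgebra K V ⊗[K] TensorAlgebra K V} (ht : t ∈ rightWords K V) :
    (extendMul δ).toLinearMap.lTensor (TensorAlgebra K V) t =
      (extendHalf δl δ).lTensor (TensorAlgebra K V) t +
        (extendHalf δr δ).lTensor (TensorAlgebra K V) t := by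
  induction ht using Submodule.span_induction with
  | mem t ht =>
    obtain ⟨z, u, y, rfl⟩ := ht
    simp [extendMul_ι, extendHalf_ι_mul, hδ, TensorProduct.tmul_add, add_mul]
  | zero => simp
  | add x y _ _ hx hy => rw [map_add, hx, hy, map_add, map_add]; abel
  | smul c x _ hx => rw [map_smul, hx, map_smul, map_smul, smul_add]

/-- The identities satisfied on letters by the half-coproducts of an unshuffle bialgebra
structure on a tensor algebra. -/
structure IsUnshuffle (δl δr δ : V →ₗ[K] TensorAlgebra K V ⊗[K] TensorAlgebra K V) : Prop where
  eq_add : ∀ v, δ v = δl v + δr v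
  left_mem : ∀ v, δl v ∈ leftLetters K V
  right_mem : ∀ v, δr v ∈ rightWords K V
  left_left : ∀ v, TensorProduct.assoc K _ _ _
      ((extendHalf δl δ).rTensor (TensorAlgebra K V) (δl v)) =
    (extendMul δ).toLinearMap.lTensor (TensorAlgebra K V) (δl v)
  right_left : ∀ v, TensorProduct.assoc K _ _ _
      ((extendHalf δr δ).rTensor (TensorAlgebra K V) (δl v)) =
    (extendHalf δl δ).lTensor (TensorAlgebra K V) (δr v)
  right_right : ∀ v, TensorProduct.assoc K _ _ _
      ((extendMul δ).toLinearMap.rTensor (TensorAlgebra K V) (δr v)) =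
    (extendHalf δr δ).lTensor (TensorAlgebra K V) (δr v)

theorem assoc_mul (x y : (TensorAlgebra K V ⊗[K] TensorAlgebra K V) ⊗[K] TensorAlgebra K V) :
    TensorProduct.assoc K _ _ _ (x * y) =
      TensorProduct.assoc K _ _ _ x * TensorProduct.assoc K _ _ _ y :=
  map_mul (Algebra.TensorProduct.assoc K K K (TensorAlgebra K V) (TensorAlgebra K V)
    (TensorAlgebra K V)) x y

namespace IsUnshuffle

variable {δl δr δ : V →ₗ[K] TensorAlgebra K V ⊗[K] TensorAlgebra K V}

/-- Both sides are algebra morphisms, so letters suffice. There, with δ = δl + δr, coassociativity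
is the sum of the three identities of `IsUnshuffle`. -/
theorem coassoc (h : IsUnshuffle δl δr δ) (x : TensorAlgebra K V) :
    TensorProduct.assoc K _ _ _
        (Algebra.TensorProduct.map (extendMul δ) (AlgHom.id K _) (extendMul δ x)) =
      Algebra.TensorProduct.map (AlgHom.id K _) (extendMul δ) (extendMul δ x) := by
  have key : ((Algebra.TensorProduct.assoc K K K (TensorAlgebra K V) (TensorAlgebra K V)
      (TensorAlgebra K V)).toAlgHom.comp
        (Algebra.TensorProduct.map (extendMul δ) (AlgHom.id K _))).comp (extendMul δ) =
      (Algebra.TensorProduct.map (AlgHom.id K _) (extendMul δ)).comp (extendMul δ) := by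
    refine TensorAlgebra.hom_ext (LinearMap.ext fun v => ?_)
    change TensorProduct.assoc K _ _ _ ((extendMul δ).toLinearMap.rTensor (TensorAlgebra K V)
      (extendMul δ (TensorAlgebra.ι K v))) = (extendMul δ).toLinearMap.lTensor
        (TensorAlgebra K V) (extendMul δ (TensorAlgebra.ι K v))
    rw [extendMul_ι, h.eq_add, map_add, map_add, map_add, rTensor_extendMul h.eq_add (h.left_mem v),
      lTensor_extendMul h.eq_add (h.right_mem v), h.right_right, map_add, h.left_left,
      h.right_left]
    abel
  exact DFunLike.congr_fun key x

/-- On a word v | x the identity factors as its instance for the letter v times coassociativity of Δ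
on x. The other two identities extend to words in the same way. -/
theorem half_left_left (h : IsUnshuffle δl δr δ) (x : TensorAlgebra K V) :
    TensorProduct.assoc K _ _ _
        ((extendHalf δl δ).rTensor (TensorAlgebra K V) (extendHalf δl δ x)) =
      (extendMul δ).toLinearMap.lTensor (TensorAlgebra K V) (extendHalf δl δ x) := by
  have key : (TensorProduct.assoc K _ _ _).toLinearMap ∘ₗ
      (extendHalf δl δ).rTensor (TensorAlgebra K V) ∘ₗ extendHalf δl δ =
      (extendMul δ).toLinearMap.lTensor (TensorAlgebra K V) ∘ₗ extendHalf δl δ := by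
    refine tensorAlgebra_linearMap_ext (by simp [extendHalf_one]) fun v x => ?_
    simp only [LinearMap.comp_apply, extendHalf_ι_mul, LinearEquiv.coe_coe]
    rw [rTensor_extendHalf_mul _ _ (h.left_mem v), assoc_mul, h.left_left, h.coassoc]
    exact (map_mul (Algebra.TensorProduct.map (AlgHom.id K _) (extendMul δ)) _ _).symm
  exact LinearMap.congr_fun key x

theorem half_right_left (h : IsUnshuffle δl δr δ) (x : TensorAlgebra K V) :
    TensorProduct.assoc K _ _ _
        ((extendHalf δr δ).rTensor (TensorAlgebra K V) (extendHalf δl δ x)) =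
      (extendHalf δl δ).lTensor (TensorAlgebra K V) (extendHalf δr δ x) := by
  have key : (TensorProduct.assoc K _ _ _).toLinearMap ∘ₗ
      (extendHalf δr δ).rTensor (TensorAlgebra K V) ∘ₗ extendHalf δl δ =
      (extendHalf δl δ).lTensor (TensorAlgebra K V) ∘ₗ extendHalf δr δ := by
    refine tensorAlgebra_linearMap_ext (by simp [extendHalf_one]) fun v x => ?_
    simp only [LinearMap.comp_apply, extendHalf_ι_mul, LinearEquiv.coe_coe]
    rw [rTensor_extendHalf_mul _ _ (h.left_mem v), assoc_mul, h.right_left, h.coassoc,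
      lTensor_extendHalf_mul _ _ (h.right_mem v)]
  exact LinearMap.congr_fun key x

theorem half_right_right (h : IsUnshuffle δl δr δ) (x : TensorAlgebra K V) :
    TensorProduct.assoc K _ _ _
        ((extendMul δ).toLinearMap.rTensor (TensorAlgebra K V) (extendHalf δr δ x)) =
      (extendHalf δr δ).lTensor (TensorAlgebra K V) (extendHalf δr δ x) := by
  have key : (TensorProduct.assoc K _ _ _).toLinearMap ∘ₗ
      (extendMul δ).toLinearMap.rTensor (TensorAlgebra K V) ∘ₗ extendHalf δr δ =
      (extendHalf δr δ).lTensor (TensorAlgebra K V) ∘ₗ extendHalf δr δ := by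
    refine tensorAlgebra_linearMap_ext (by simp [extendHalf_one]) fun v x => ?_
    simp only [LinearMap.comp_apply, extendHalf_ι_mul, LinearEquiv.coe_coe]
    rw [lTensor_extendHalf_mul _ _ (h.right_mem v), ← h.right_right, ← h.coassoc, ← assoc_mul]
    congr 1
    exact map_mul (Algebra.TensorProduct.map (extendMul δ) (AlgHom.id K _)) _ _
  exact LinearMap.congr_fun key x

end IsUnshuffle

/-- The product of two linear forms as a linear form on the tensor product. -/
noncomputable abbrev formMul {X Y : Type*} [AddCommMonoid X] [Module K X] [AddCommMonoid Y]
    [Module K Y] (f : Module.Dual K X) (g : Module.Dual K Y) : Module.Dual K (X ⊗[K] Y) :=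
  LinearMap.mul' K K ∘ₗ TensorProduct.map f g

/-- Together with `formMul_lTensor`, this rewrites each nested half-product of f, g, h as f ⊗ g ⊗ h
evaluated on an iterated coproduct, where the unshuffle identities apply. -/
theorem formMul_rTensor {X Y Z W : Type*} [AddCommMonoid X] [Module K X] [AddCommMonoid Y]
    [Module K Y] [AddCommMonoid Z] [Module K Z] [AddCommMonoid W] [Module K W]
    (f : Module.Dual K X) (g : Module.Dual K Y)
    (h : Module.Dual K Z) (D : W →ₗ[K] X ⊗[K] Y) (t : W ⊗[K] Z) :
    formMul (formMul f g ∘ₗ D) h t =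
      formMul f (formMul g h) (TensorProduct.assoc K _ _ _ (D.rTensor Z t)) := by
  have key : ∀ (z : Z) (s : X ⊗[K] Y), formMul f g s * h z =
      formMul f (formMul g h) (TensorProduct.assoc K _ _ _ (s ⊗ₜ z)) := by
    intro z s
    induction s using TensorProduct.induction_on with
    | zero => simp
    | tmul x y => simp [mul_assoc]
    | add x y hx hy => rw [map_add, add_mul, hx, hy, TensorProduct.add_tmul, map_add, map_add]
  induction t using TensorProduct.induction_on with
  | zero => simp
  | tmul w z => simpa using key z (D w)
  | add x y hx hy => rw [map_add, hx, hy, map_add, map_add, map_add]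

theorem formMul_lTensor {X Y Z W : Type*} [AddCommMonoid X] [Module K X] [AddCommMonoid Y]
    [Module K Y] [AddCommMonoid Z] [Module K Z] [AddCommMonoid W] [Module K W]
    (f : Module.Dual K X) (g : Module.Dual K Y)
    (h : Module.Dual K Z) (D : W →ₗ[K] Y ⊗[K] Z) (t : X ⊗[K] W) :
    formMul f (formMul g h ∘ₗ D) t = formMul f (formMul g h) (D.lTensor X t) := by
  induction t using TensorProduct.induction_on with
  | zero => simp
  | tmul w z => simp
  | add x y hx hy => rw [map_add, hx, hy, map_add, map_add]

/-! ### The unital shuffle algebra of linear forms -/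

variable (Δl Δr : TensorAlgebra K V →ₗ[K] TensorAlgebra K V ⊗[K] TensorAlgebra K V)

theorem mem_aug_dualProducts {f : Module.Dual K (TensorAlgebra K V)} :
    f ∈ (dualProducts Δl Δr).aug ↔ f 1 = 0 := by
  simp [dualProducts]

theorem posPart_apply (x : TensorAlgebra K V) : posPart K V x = x - augForm K V x • 1 := by
  simp [posPart, Algebra.algebraMap_eq_smul_one]

theorem formPos_apply (f : Module.Dual K (TensorAlgebra K V)) :
    formPos K V f = f - f 1 • augForm K V := by
  simp [formPos]

/-- The term x ⊗ 1 separating Δ⁺_≺ from Δ_≺ is killed by g(1) = 0, so the axioms can be checked on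
the unreduced half-coproducts, which have the simpler combinatorics. -/
theorem dualProducts_prec_eq {Δl} (h₁ : Δl 1 = 0) {f g : Module.Dual K (TensorAlgebra K V)}
    (hf : f 1 = 0) (hg : g 1 = 0) :
    (dualProducts Δl Δr).prec f g = formMul f g ∘ₗ Δl := by
  rw [(dualProducts_of_mem Δl Δr hf hg).1]
  ext1 x
  simp [halfLeft, posPart_apply, h₁, hg]

theorem dualProducts_succ_eq {Δr} (h₁ : Δr 1 = 0) {f g : Module.Dual K (TensorAlgebra K V)}
    (hf : f 1 = 0) (hg : g 1 = 0) :
    (dualProducts Δl Δr).succ f g = formMul f g ∘ₗ Δr := by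
  rw [(dualProducts_of_mem Δl Δr hf hg).2]
  ext1 x
  simp [halfRight, posPart_apply, h₁, hf]

/-- Only the three shuffle axioms depend on the half-coproducts. The decomposition f = (f - f(1) e)
+ f(1) e and the unit rules hold for every choice of them. -/
theorem dualProducts_isUnitalShuffleAlgebra
    (prec_prec : ∀ a ∈ (dualProducts Δl Δr).aug, ∀ b ∈ (dualProducts Δl Δr).aug,
      ∀ c ∈ (dualProducts Δl Δr).aug,
      (dualProducts Δl Δr).prec ((dualProducts Δl Δr).prec a b) c =
        (dualProducts Δl Δr).prec a
          ((dualProducts Δl Δr).prec b c + (dualProducts Δl Δr).succ b c))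
    (succ_prec : ∀ a ∈ (dualProducts Δl Δr).aug, ∀ b ∈ (dualProducts Δl Δr).aug,
      ∀ c ∈ (dualProducts Δl Δr).aug,
      (dualProducts Δl Δr).prec ((dualProducts Δl Δr).succ a b) c =
        (dualProducts Δl Δr).succ a ((dualProducts Δl Δr).prec b c))
    (succ_succ : ∀ a ∈ (dualProducts Δl Δr).aug, ∀ b ∈ (dualProducts Δl Δr).aug,
      ∀ c ∈ (dualProducts Δl Δr).aug,
      (dualProducts Δl Δr).succ a ((dualProducts Δl Δr).succ b c) =
        (dualProducts Δl Δr).succ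
          ((dualProducts Δl Δr).prec a b + (dualProducts Δl Δr).succ a b) c) :
    (dualProducts Δl Δr).IsUnitalShuffleAlgebra where
  one_ne_zero h := by
    have h₁ := LinearMap.congr_fun (h : augForm K V = 0) 1
    exact one_ne_zero ((augForm_one (K := K) (V := V)).symm.trans h₁)
  isCompl := by
    refine IsCompl.of_eq ?_ ?_
    · rw [eq_bot_iff]
      rintro f ⟨hf, hf'⟩
      obtain ⟨c, rfl⟩ := Submodule.mem_span_singleton.1 hf'
      have hc := (mem_aug_dualProducts Δl Δr).1 hf
      have : c = 0 := by simpa [dualProducts, augForm_one] using hc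
      simp [this]
    · rw [eq_top_iff]
      rintro f -
      rw [Submodule.mem_sup]
      refine ⟨f - f 1 • augForm K V, ?_, f 1 • augForm K V,
        Submodule.smul_mem _ _ (Submodule.mem_span_singleton_self _), by simp⟩
      rw [mem_aug_dualProducts]
      simp [augForm_one]
  prec_mem f hf g hg := by
    rw [mem_aug_dualProducts] at *
    rw [(dualProducts_of_mem Δl Δr hf hg).1]
    simp [halfLeft, posPart_apply, augForm_one]
  succ_mem f hf g hg := by
    rw [mem_aug_dualProducts] at *
    rw [(dualProducts_of_mem Δl Δr hf hg).2]
    simp [halfRight, posPart_apply, augForm_one]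
  prec_prec := prec_prec
  succ_prec := succ_prec
  succ_succ := succ_succ
  prec_one f hf := by
    rw [mem_aug_dualProducts] at hf
    simp [dualProducts, formPos_apply, augForm_one, hf]
  one_succ f hf := by
    rw [mem_aug_dualProducts] at hf
    simp [dualProducts, formPos_apply, augForm_one, hf]
  one_prec f hf := by
    rw [mem_aug_dualProducts] at hf
    simp [dualProducts, formPos_apply, augForm_one, hf]
  succ_one f hf := by
    rw [mem_aug_dualProducts] at hf
    simp [dualProducts, formPos_apply, augForm_one, hf]

theorem IsUnshuffle.isUnitalShuffleAlgebra
    {δl δr δ : V →ₗ[K] TensorAlgebra K V ⊗[K] TensorAlgebra K V} (h : IsUnshuffle δl δr δ) :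
    (dualProducts (extendHalf δl δ) (extendHalf δr δ)).IsUnitalShuffleAlgebra := by
  have hp : ∀ {f g : Module.Dual K (TensorAlgebra K V)}, f 1 = 0 → g 1 = 0 →
      (dualProducts (extendHalf δl δ) (extendHalf δr δ)).prec f g =
        formMul f g ∘ₗ extendHalf δl δ :=
    dualProducts_prec_eq _ (extendHalf_one δl δ)
  have hs : ∀ {f g : Module.Dual K (TensorAlgebra K V)}, f 1 = 0 → g 1 = 0 →
      (dualProducts (extendHalf δl δ) (extendHalf δr δ)).succ f g =
        formMul f g ∘ₗ extendHalf δr δ :=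
    dualProducts_succ_eq _ (extendHalf_one δr δ)
  have hp₁ : ∀ f g : Module.Dual K (TensorAlgebra K V),
      (formMul f g ∘ₗ extendHalf δl δ) 1 = 0 := fun f g => by simp [extendHalf_one]
  have hs₁ : ∀ f g : Module.Dual K (TensorAlgebra K V),
      (formMul f g ∘ₗ extendHalf δr δ) 1 = 0 := fun f g => by simp [extendHalf_one]
  -- The sum of the two half-products is the convolution for Δ, since the leftover ε · (1 ⊗ 1) is
  -- killed by f(1) = 0.
  have hadd : ∀ {f g : Module.Dual K (TensorAlgebra K V)}, f 1 = 0 →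
      formMul f g ∘ₗ extendHalf δl δ + formMul f g ∘ₗ extendHalf δr δ =
        formMul f g ∘ₗ (extendMul δ).toLinearMap := by
    intro f g hf
    ext1 x
    simp [extendMul_eq_add h.eq_add x, Algebra.TensorProduct.one_def, hf]
  have hm₁ : ∀ {f : Module.Dual K (TensorAlgebra K V)} (g : Module.Dual K (TensorAlgebra K V)),
      f 1 = 0 → (formMul f g ∘ₗ (extendMul δ).toLinearMap) 1 = 0 := fun g hf => by
    simp [Algebra.TensorProduct.one_def, hf]
  refine dualProducts_isUnitalShuffleAlgebra _ _ ?_ ?_ ?_ <;>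
    intro a ha b hb c hc <;> rw [mem_aug_dualProducts] at ha hb hc
  · rw [hp ha hb, hp hb hc, hs hb hc, hadd hb, hp (hp₁ a b) hc, hp ha (hm₁ c hb)]
    ext1 x
    refine (formMul_rTensor ..).trans (Eq.trans ?_ (formMul_lTensor ..).symm)
    rw [h.half_left_left]
  · rw [hs ha hb, hp hb hc, hp (hs₁ a b) hc, hs ha (hp₁ b c)]
    ext1 x
    refine (formMul_rTensor ..).trans (Eq.trans ?_ (formMul_lTensor ..).symm)
    rw [h.half_right_left]
  · rw [hs ha hb, hp ha hb, hs hb hc, hadd ha, hs ha (hs₁ b c), hs (hm₁ b ha) hc]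
    ext1 x
    refine (formMul_lTensor ..).trans (Eq.trans ?_ (formMul_rTensor ..).symm)
    rw [h.half_right_right]

end Abstract

/-! ### Morphisms of tensor algebras and their transposes -/

section Morphisms

variable {K : Type*} [Field K] {V : Type*} [AddCommMonoid V] [Module K V]
  {W : Type*} [AddCommMonoid W] [Module K W]

/-- The morphism of tensor algebras induced by a linear map. -/
noncomputable def tensorMap (φ : V →ₗ[K] W) : TensorAlgebra K V →ₐ[K] TensorAlgebra K W :=
  TensorAlgebra.lift K (TensorAlgebra.ι K ∘ₗ φ)

theorem tensorMap_ι (φ : V →ₗ[K] W) (v : V) :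
    tensorMap φ (TensorAlgebra.ι K v) = TensorAlgebra.ι K (φ v) := by
  simp [tensorMap]

theorem augForm_tensorMap (φ : V →ₗ[K] W) (x : TensorAlgebra K V) :
    augForm K W (tensorMap φ x) = augForm K V x := by
  have : augForm K W ∘ₗ (tensorMap φ).toLinearMap = augForm K V :=
    tensorAlgebra_linearMap_ext (by simp [augForm_one]) fun v x => by
      simp [tensorMap_ι, augForm_ι_mul]
  exact LinearMap.congr_fun this x

/-- The square of a morphism of tensor algebras. -/
noncomputable abbrev tensorMapSq (φ : V →ₗ[K] W) :
    TensorAlgebra K V ⊗[K] TensorAlgebra K V →ₐ[K] TensorAlgebra K W ⊗[K] TensorAlgebra K W :=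
  Algebra.TensorProduct.map (tensorMap φ) (tensorMap φ)

theorem extendMul_tensorMap {φ : V →ₗ[K] W}
    {δ : V →ₗ[K] TensorAlgebra K V ⊗[K] TensorAlgebra K V}
    {ε : W →ₗ[K] TensorAlgebra K W ⊗[K] TensorAlgebra K W}
    (h : ∀ v, tensorMapSq φ (δ v) = ε (φ v)) (x : TensorAlgebra K V) :
    extendMul ε (tensorMap φ x) = tensorMapSq φ (extendMul δ x) := by
  have : (extendMul ε).comp (tensorMap φ) = (tensorMapSq φ).comp (extendMul δ) := by
    refine TensorAlgebra.hom_ext (LinearMap.ext fun v => ?_)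
    simpa only [LinearMap.comp_apply, AlgHom.toLinearMap_apply, AlgHom.comp_apply, tensorMap_ι,
      extendMul_ι] using (h v).symm
  exact DFunLike.congr_fun this x

theorem extendHalf_tensorMap {φ : V →ₗ[K] W}
    {δ₀ δ : V →ₗ[K] TensorAlgebra K V ⊗[K] TensorAlgebra K V}
    {ε₀ ε : W →ₗ[K] TensorAlgebra K W ⊗[K] TensorAlgebra K W}
    (h₀ : ∀ v, tensorMapSq φ (δ₀ v) = ε₀ (φ v)) (h : ∀ v, tensorMapSq φ (δ v) = ε (φ v))
    (x : TensorAlgebra K V) :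
    extendHalf ε₀ ε (tensorMap φ x) = tensorMapSq φ (extendHalf δ₀ δ x) := by
  have : extendHalf ε₀ ε ∘ₗ (tensorMap φ).toLinearMap =
      (tensorMapSq φ).toLinearMap ∘ₗ extendHalf δ₀ δ := by
    refine tensorAlgebra_linearMap_ext (by simp [extendHalf_one]) fun v x => ?_
    simp only [LinearMap.comp_apply, AlgHom.toLinearMap_apply, map_mul, tensorMap_ι,
      extendHalf_ι_mul, extendMul_tensorMap h, h₀]
  exact LinearMap.congr_fun this x

/-- The induced algebra morphism preserves the augmentation, hence commutes with the projections to
positive words and to forms vanishing at 1. Compatibility with the unreduced half-coproducts then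
suffices. -/
theorem isMorphism_transpose_tensorMap {φ : V →ₗ[K] W}
    {Δl Δr : TensorAlgebra K V →ₗ[K] TensorAlgebra K V ⊗[K] TensorAlgebra K V}
    {Γl Γr : TensorAlgebra K W →ₗ[K] TensorAlgebra K W ⊗[K] TensorAlgebra K W}
    (hl : ∀ x, Γl (tensorMap φ x) = tensorMapSq φ (Δl x))
    (hr : ∀ x, Γr (tensorMap φ x) = tensorMapSq φ (Δr x)) :
    (dualProducts Γl Γr).IsMorphism (dualProducts Δl Δr)
      (Module.Dual.transpose (tensorMap φ).toLinearMap) := by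
  have hpos : ∀ x, posPart K W (tensorMap φ x) = tensorMap φ (posPart K V x) := fun x => by
    simp [posPart_apply, augForm_tensorMap]
  have hform : ∀ f, formPos K V (f ∘ₗ (tensorMap φ).toLinearMap) =
      formPos K W f ∘ₗ (tensorMap φ).toLinearMap := fun f => by
    ext1 x
    simp [formPos_apply, augForm_tensorMap]
  have hmul : ∀ (f g : Module.Dual K (TensorAlgebra K W)) t,
      formMul (f ∘ₗ (tensorMap φ).toLinearMap) (g ∘ₗ (tensorMap φ).toLinearMap) t =
        formMul f g (tensorMapSq φ t) := fun f g t => by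
    induction t using TensorProduct.induction_on with
    | zero => simp
    | tmul x y => simp
    | add x y hx hy => rw [map_add, hx, hy, map_add, map_add]
  have hleft : ∀ x, halfLeft Γl (tensorMap φ x) = tensorMapSq φ (halfLeft Δl x) := fun x => by
    simp [halfLeft, hpos, hl]
  have hright : ∀ x, halfRight Γr (tensorMap φ x) = tensorMapSq φ (halfRight Δr x) := fun x => by
    simp [halfRight, hpos, hr]
  refine ⟨?_, ?_, ?_, ?_⟩
  · ext1 x
    exact augForm_tensorMap φ x
  · intro f hf
    rw [mem_aug_dualProducts] at hf ⊢
    simpa [Module.Dual.transpose] using hf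
  · intro f g _
    ext1 x
    have h₁ := hmul (formPos K W f) (formPos K W g) (halfLeft Δl x)
    have h₂ : ∀ f, (Module.Dual.transpose (tensorMap φ).toLinearMap : _ →ₗ[K] _) f =
      f ∘ₗ (tensorMap φ).toLinearMap := fun _ => rfl
    simp only [LinearMap.comp_apply] at h₁
    simp [dualProducts, convolution, h₂, hform, hleft, h₁]
  · intro f g _
    ext1 x
    have h₁ := hmul (formPos K W f) (formPos K W g) (halfRight Δr x)
    have h₂ : ∀ f, (Module.Dual.transpose (tensorMap φ).toLinearMap : _ →ₗ[K] _) f =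
      f ∘ₗ (tensorMap φ).toLinearMap := fun _ => rfl
    simp only [LinearMap.comp_apply] at h₁
    simp [dualProducts, convolution, h₂, hform, hright, h₁]

/-- A left inverse ψ makes the transpose surjective on forms vanishing at 1, with preimages obtained
by composing with the map induced by ψ. Identities of half-products pass to the image of a morphism.
-/
theorem isUnitalShuffleAlgebra_of_tensorMap {φ : V →ₗ[K] W} {ψ : W →ₗ[K] V}
    (hψ : ∀ v, ψ (φ v) = v)
    {Δl Δr : TensorAlgebra K V →ₗ[K] TensorAlgebra K V ⊗[K] TensorAlgebra K V}
    {Γl Γr : TensorAlgebra K W →ₗ[K] TensorAlgebra K W ⊗[K] TensorAlgebra K W}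
    (hΓ : (dualProducts Γl Γr).IsUnitalShuffleAlgebra)
    (h : (dualProducts Γl Γr).IsMorphism (dualProducts Δl Δr)
      (Module.Dual.transpose (tensorMap φ).toLinearMap)) :
    (dualProducts Δl Δr).IsUnitalShuffleAlgebra := by
  have hinv : ∀ x, tensorMap ψ (tensorMap φ x) = x := fun x => by
    have : (tensorMap ψ).comp (tensorMap φ) = AlgHom.id K _ :=
      TensorAlgebra.hom_ext (LinearMap.ext fun v => by simp [tensorMap_ι, hψ])
    exact DFunLike.congr_fun this x
  have hsurj : ∀ f ∈ (dualProducts Δl Δr).aug, ∃ f' ∈ (dualProducts Γl Γr).aug,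
      (Module.Dual.transpose (tensorMap φ).toLinearMap : _ →ₗ[K] _) f' = f := by
    intro f hf
    rw [mem_aug_dualProducts] at hf
    refine ⟨f ∘ₗ (tensorMap ψ).toLinearMap, ?_, ?_⟩
    · rw [mem_aug_dualProducts]
      simpa using hf
    · ext1 x
      exact congrArg f (hinv x)
  refine dualProducts_isUnitalShuffleAlgebra _ _ ?_ ?_ ?_ <;>
    intro a ha b hb c hc <;> obtain ⟨a, ha', rfl⟩ := hsurj a ha <;>
    obtain ⟨b, hb', rfl⟩ := hsurj b hb <;> obtain ⟨c, hc', rfl⟩ := hsurj c hc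
  · rw [← h.map_prec _ _ (Or.inl ha'), ← h.map_prec _ _ (Or.inr hc'), hΓ.prec_prec a ha' b hb' c hc',
      h.map_prec _ _ (Or.inl ha'), map_add, h.map_prec _ _ (Or.inl hb'), h.map_succ _ _ (Or.inl hb')]
  · rw [← h.map_succ _ _ (Or.inl ha'), ← h.map_prec _ _ (Or.inr hc'), hΓ.succ_prec a ha' b hb' c hc',
      h.map_succ _ _ (Or.inl ha'), h.map_prec _ _ (Or.inl hb')]
  · rw [← h.map_succ _ _ (Or.inl hb'), ← h.map_succ _ _ (Or.inl ha'), hΓ.succ_succ a ha' b hb' c hc',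
      h.map_succ _ _ (Or.inr hc'), map_add, h.map_prec _ _ (Or.inl ha'), h.map_succ _ _ (Or.inl ha')]

end Morphisms

/-! ### Ordered products of sums over subsets -/

section ListSums

variable {ι α : Type*} [DecidableEq α]

/-- The union of the sets indexed by a list. -/
def listUnion (E : ι → Finset α) (l : List ι) : Finset α := l.foldr (fun i s => E i ∪ s) ∅

theorem mem_listUnion {E : ι → Finset α} {l : List ι} {x : α} :
    x ∈ listUnion E l ↔ ∃ i ∈ l, x ∈ E i := by
  induction l with
  | nil => simp [listUnion]
  | cons i l ih =>
    have : listUnion E (i :: l) = E i ∪ listUnion E l := rfl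
    simp [this, ih]

theorem sum_powerset_union {M : Type*} [AddCommMonoid M] {A B : Finset α} (h : Disjoint A B)
    (f : Finset α → Finset α → M) :
    ∑ R ∈ (A ∪ B).powerset, f (R ∩ A) (R ∩ B) =
      ∑ R₁ ∈ A.powerset, ∑ R₂ ∈ B.powerset, f R₁ R₂ := by
  rw [← Finset.sum_product']
  have hd : ∀ x, x ∈ A → x ∉ B := fun _ hx => Finset.disjoint_left.1 h hx
  refine Finset.sum_bij' (fun R _ => (R ∩ A, R ∩ B)) (fun R _ => R.1 ∪ R.2) ?_ ?_ ?_ ?_ ?_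
  · intro R _
    simp
  · rintro ⟨R₁, R₂⟩ hR
    simp only [Finset.mem_product, Finset.mem_powerset] at hR ⊢
    exact Finset.union_subset_union hR.1 hR.2
  · intro R hR
    rw [Finset.mem_powerset] at hR
    rw [← Finset.inter_union_distrib_left, Finset.inter_eq_left.2 hR]
  · rintro ⟨R₁, R₂⟩ hR
    simp only [Finset.mem_product, Finset.mem_powerset] at hR
    ext x
    · have := @hR.1 x
      have := @hR.2 x
      have := hd x
      simp only [Finset.mem_inter, Finset.mem_union]
      tauto
    · have := @hR.1 x
      have := @hR.2 x
      have := hd x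
      simp only [Finset.mem_inter, Finset.mem_union]
      tauto
  · intros; rfl

/-- This is distributivity: choosing a subset of each of several disjoint sets amounts to choosing
one subset of their union. It serves with E the components themselves, for coassociativity, and with
E their squares J × J, for the splitting map. -/
theorem prod_sum_powerset {B : Type*} [Semiring B] (E : ι → Finset α) (F : ι → Finset α → B)
    (l : List ι) (hl : l.Pairwise fun i j => Disjoint (E i) (E j)) :
    (l.map fun i => ∑ T ∈ (E i).powerset, F i T).prod =
      ∑ T ∈ (listUnion E l).powerset, (l.map fun i => F i (T ∩ E i)).prod := by
  induction l with
  | nil => simp [listUnion]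
  | cons i l ih =>
    rw [List.pairwise_cons] at hl
    have hdisj : Disjoint (E i) (listUnion E l) := by
      rw [Finset.disjoint_left]
      intro x hx hx'
      obtain ⟨j, hj, hxj⟩ := mem_listUnion.1 hx'
      exact Finset.disjoint_left.1 (hl.1 j hj) hx hxj
    have hunion : listUnion E (i :: l) = E i ∪ listUnion E l := rfl
    rw [List.map_cons, List.prod_cons, ih hl.2, Finset.sum_mul_sum, hunion]
    rw [← sum_powerset_union hdisj
      (fun R₁ R₂ => F i R₁ * (l.map fun i => F i (R₂ ∩ E i)).prod)]
    refine Finset.sum_congr rfl fun T _ => ?_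
    rw [List.map_cons, List.prod_cons]
    congr 2
    refine List.map_congr_left fun j hj => ?_
    rw [Finset.inter_assoc, Finset.inter_eq_right.2 fun x hx => mem_listUnion.2 ⟨j, hj, hx⟩]

theorem prod_map_onlyIf {B : Type*} [MonoidWithZero B] (P : ι → Prop) (f : ι → B) (l : List ι) :
    (l.map fun i => onlyIf (P i) (f i)).prod =
      onlyIf (∀ i ∈ l, P i) (l.map f).prod := by
  induction l with
  | nil => simp [onlyIf]
  | cons i l ih =>
    simp only [List.map_cons, List.prod_cons, ih, List.mem_cons, forall_eq_or_imp]
    rw [onlyIf_and]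
    by_cases h : P i
    · by_cases h' : ∀ i ∈ l, P i
      · simp only [onlyIf_pos h, onlyIf_pos h']
      · simp only [onlyIf_pos h, onlyIf_neg h', mul_zero]
    · simp only [onlyIf_neg h, zero_mul]

theorem prod_map_tmul {K B C : Type*} [CommSemiring K] [Semiring B] [Algebra K B] [Semiring C]
    [Algebra K C] (f : ι → B) (g : ι → C) (l : List ι) :
    (l.map fun i => f i ⊗ₜ[K] g i).prod = (l.map f).prod ⊗ₜ[K] (l.map g).prod := by
  induction l with
  | nil => simp [Algebra.TensorProduct.one_def]
  | cons i l ih => simp [ih]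

theorem sum_powerset_compl [Fintype α] {M : Type*} [AddCommMonoid M] (S : Finset α)
    (f : Finset α → M) :
    ∑ T ∈ Sᶜ.powerset, f T = ∑ S' : Finset α, onlyIf (S ⊆ S') (f (S' \ S)) := by
  rw [sum_onlyIf]
  refine Finset.sum_bij' (fun T _ => S ∪ T) (fun S' _ => S' \ S) ?_ ?_ ?_ ?_ ?_
  · intro T _
    simp
  · intro S' _
    rw [Finset.mem_powerset]
    intro x hx
    simpa using (Finset.mem_sdiff.1 hx).2
  · intro T hT
    rw [Finset.mem_powerset] at hT
    ext x
    have := @hT x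
    simp only [Finset.mem_compl, Finset.mem_sdiff, Finset.mem_union] at *
    tauto
  · intro S' hS'
    simp only [Finset.mem_filter, Finset.mem_univ, true_and] at hS'
    exact Finset.union_sdiff_of_subset hS'
  · intro T hT
    rw [Finset.mem_powerset] at hT
    congr 1
    ext x
    have := @hT x
    simp only [Finset.mem_compl, Finset.mem_sdiff, Finset.mem_union] at *
    tauto

end ListSums

/-! ### Decorated non-crossing partitions and their restrictions -/

section Decorated

variable (K : Type*) [Field K] (A : Type*) [Ring A] [Algebra K A]

/-- The decorated non-crossing partition `L ⊗ a`. -/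
noncomputable def decorated {n : ℕ} (h : 0 < n) (L : NC n) (a : Fin n → A) : NCA K A :=
  DirectSum.lof K ℕ+ (fun n => (NC (n : ℕ) →₀ K) ⊗[K] (⨂[K]^(n : ℕ) A)) ⟨n, h⟩
    (Finsupp.single L 1 ⊗ₜ PiTensorProduct.tprod K a)

variable {K A}

theorem NCA.induction {P : NCA K A → Prop} (zero : P 0) (add : ∀ x y, P x → P y → P (x + y))
    (smul : ∀ (c : K) x, P x → P (c • x))
    (decorated : ∀ (n : ℕ) (h : 0 < n) (L : NC n) (a : Fin n → A), P (decorated K A h L a))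
    (x : NCA K A) : P x := by
  induction x using DirectSum.induction_on with
  | zero => exact zero
  | add x y hx hy => exact add x y hx hy
  | of n t =>
    change P (DirectSum.lof K ℕ+ (fun n => (NC (n : ℕ) →₀ K) ⊗[K] (⨂[K]^(n : ℕ) A)) n t)
    induction t using TensorProduct.induction_on with
    | zero => rw [map_zero]; exact zero
    | add x y hx hy => rw [map_add]; exact add _ _ hx hy
    | tmul l w =>
      induction l using Finsupp.induction_linear with
      | zero => rw [TensorProduct.zero_tmul, map_zero]; exact zero
      | add x y hx hy => rw [TensorProduct.add_tmul, map_add]; exact add _ _ hx hy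
      | single L c =>
        induction w using PiTensorProduct.induction_on with
        | smul_tprod r a =>
          have : (Finsupp.single L c : NC (n : ℕ) →₀ K) ⊗ₜ[K] (r • PiTensorProduct.tprod K a) =
              (c * r) • ((Finsupp.single L 1 : NC (n : ℕ) →₀ K) ⊗ₜ[K]
                PiTensorProduct.tprod K a) := by
            rw [TensorProduct.tmul_smul, TensorProduct.smul_tmul', TensorProduct.smul_tmul',
              Finsupp.smul_single, Finsupp.smul_single, smul_eq_mul, smul_eq_mul, mul_one,
              mul_comm]
          rw [this, map_smul]
          exact smul _ _ (decorated n n.pos L a)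
        | add x y hx hy => rw [TensorProduct.tmul_add, map_add]; exact add _ _ hx hy

variable (K) in
/-- The letter of `T(NC(A))` given by the restriction of `L ⊗ a` to `J`; it is the unit
if `J` is empty. -/
noncomputable abbrev restr {n : ℕ} (L : NC n) (a : Fin n → A) (J : Finset (Fin n)) :
    TensorAlgebra K (NCA K A) :=
  letter (wordNCA K A L) J a

theorem restr_empty {n : ℕ} (L : NC n) (a : Fin n → A) : restr K L a ∅ = 1 := by
  simp [restr, letter]

theorem restr_of_nonempty {n : ℕ} (L : NC n) (a : Fin n → A) {J : Finset (Fin n)}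
    (h : J.Nonempty) :
    restr K L a J =
      TensorAlgebra.ι K (decorated K A h.card_pos (L.st J) (a ∘ incl J)) := by
  simp only [restr, letter, h, dite_true]
  rfl

/-- Restricting in two steps or in one gives partitions over index types whose sizes are equal only
propositionally. Comparing block relations through a cast avoids transporting partitions. -/
theorem decorated_congr {m m' : ℕ} (hm : m = m') (h : 0 < m) (h' : 0 < m') {L : NC m}
    {L' : NC m'} {b : Fin m → A} {b' : Fin m' → A}
    (hL : ∀ i j, SameBlock L.1 i j ↔ SameBlock L'.1 (Fin.cast hm i) (Fin.cast hm j))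
    (hb : ∀ i, b i = b' (Fin.cast hm i)) :
    decorated K A h L b = decorated K A h' L' b' := by
  subst hm
  obtain rfl : L = L' := NC.ext_sameBlock hL
  obtain rfl : b = b' := funext hb
  rfl

theorem incl_map {n : ℕ} (U : Finset (Fin n)) (T : Finset (Fin U.card))
    (i : Fin T.card) :
    incl (T.map (incl U).toEmbedding) (Fin.cast (Finset.card_map _).symm i) =
      incl U (incl T i) := by
  have h := Finset.orderEmbOfFin_unique (s := T.map (incl U).toEmbedding)
    (k := (T.map (incl U).toEmbedding).card) rfl
    (f := fun i => incl U (incl T (Fin.cast (Finset.card_map _) i))) ?_ ?_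
  · have := congrFun h (Fin.cast (Finset.card_map _).symm i)
    simpa using this.symm
  · intro i
    exact Finset.mem_map_of_mem _ (incl_mem T _)
  · intro i j hij
    exact (incl U).strictMono ((incl T).strictMono (by simpa using hij))

/-- Standardization is transitive, because the increasing enumeration of a subset of U is a
composite of two increasing enumerations. All iterated coproducts can thus be indexed by subsets of
the original [n]. -/
theorem restr_st {n : ℕ} (L : NC n) (a : Fin n → A) (U : Finset (Fin n))
    (T : Finset (Fin U.card)) :
    restr K (L.st U) (a ∘ incl U) T = restr K L a (T.map (incl U).toEmbedding) := by
  by_cases hT : T.Nonempty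
  · have hT' : (T.map (incl U).toEmbedding).Nonempty := hT.map
    rw [restr_of_nonempty _ _ hT, restr_of_nonempty _ _ hT']
    congr 1
    refine decorated_congr (Finset.card_map _).symm _ _ ?_ ?_
    · intro i j
      simp only [NC.st]
      rw [sameBlock_stdRestrict, sameBlock_stdRestrict, sameBlock_stdRestrict]
      rw [incl_map, incl_map]
    · intro i
      simp only [Function.comp_apply, incl_map]
  · rw [Finset.not_nonempty_iff_eq_empty] at hT
    subst hT
    rw [Finset.map_empty, restr_empty, restr_empty]

/-- The condition `c` on whether a subset contains the first element. -/
def firstCond (c : Prop → Prop) : SubsetCond := fun n S => c ((⟨0, n.pos⟩ : Fin n) ∈ S)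

theorem coprodNCA_decorated (p : SubsetCond) {n : ℕ} (h : 0 < n) (L : NC n) (a : Fin n → A) :
    coprodNCA K A p (decorated K A h L a) =
      ∑ S : Finset (Fin n), onlyIf (Compat L S ∧ p ⟨n, h⟩ S)
        (restr K L a S ⊗ₜ ((components S).map (restr K L a)).prod) := by
  have key : ∀ (n : ℕ+) (L : NC n) (a : Fin n → A), coprodNCA K A p
      (DirectSum.lof K ℕ+ (fun n => (NC (n : ℕ) →₀ K) ⊗[K] (⨂[K]^(n : ℕ) A)) n
        (Finsupp.single L 1 ⊗ₜ PiTensorProduct.tprod K a)) =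
      ∑ S : Finset (Fin n), onlyIf (Compat L S ∧ p n S)
        (restr K L a S ⊗ₜ ((components S).map (restr K L a)).prod) := by
    intro n L a
    rw [coprodNCA, DirectSum.toModule_lof, liftNC, TensorProduct.lift.tmul,
      Finsupp.linearCombination_single, one_smul, LinearMap.sum_apply]
    simp only [splitTerm_tprod]
    exact sum_admissible L (p n)
      (fun S => restr K L a S ⊗ₜ ((components S).map (restr K L a)).prod)
  exact key ⟨n, h⟩ L a

/-- The summand of the coproduct of the restriction of `L ⊗ a` to `U` indexed by `T`. -/
noncomputable def relTerm {n : ℕ} (L : NC n) (a : Fin n → A) (U T : Finset (Fin n)) :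
    TensorAlgebra K (NCA K A) ⊗[K] TensorAlgebra K (NCA K A) :=
  onlyIf (RelCompat L U T) (restr K L a T ⊗ₜ ((relComponents U T).map (restr K L a)).prod)

/-- The coproduct of a restricted letter, transported back from the standardized index set to
subsets of U. The first position after standardization corresponds to the minimum m of U. -/
theorem coprodNCA_restr (c : Prop → Prop) {n : ℕ} (L : NC n) (a : Fin n → A)
    {U : Finset (Fin n)} (hU : U.Nonempty) {m : Fin n} (hm : m ∈ U) (hmin : ∀ x ∈ U, m ≤ x) :
    coprodNCA K A (firstCond c) (decorated K A hU.card_pos (L.st U) (a ∘ incl U)) =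
      ∑ T ∈ U.powerset, onlyIf (c (m ∈ T)) (relTerm L a U T) := by
  rw [coprodNCA_decorated]
  refine Finset.sum_bij' (fun T _ => T.map (incl U).toEmbedding) (fun T _ => pullBlock U T)
    ?_ ?_ ?_ ?_ ?_
  · intro T _
    rw [Finset.mem_powerset]
    intro x hx
    obtain ⟨x, -, rfl⟩ := Finset.mem_map.1 hx
    exact incl_mem U x
  · intros
    exact Finset.mem_univ _
  · intro T _
    exact pullBlock_map T
  · intro T hT
    rw [map_pullBlock, Finset.inter_eq_right.2 (Finset.mem_powerset.1 hT)]
  · intro T _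
    have h₁ : Compat (L.st U) T ↔ RelCompat L U (T.map (incl U).toEmbedding) := by
      rw [← compat_st_iff, pullBlock_map]
    have h₂ : m = incl U ⟨0, hU.card_pos⟩ := by
      refine le_antisymm (hmin _ (incl_mem U _)) ?_
      obtain ⟨j, rfl⟩ := exists_incl_eq hm
      exact (incl U).monotone (Fin.mk_le_of_le_val (Nat.zero_le _))
    have h₃ : m ∈ T.map (incl U).toEmbedding ↔ (⟨0, hU.card_pos⟩ : Fin U.card) ∈ T := by
      rw [h₂]
      exact Finset.mem_map' (incl U).toEmbedding
    have h₄ : (components T).map (restr K (L.st U) (a ∘ incl U)) =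
        (relComponents U (T.map (incl U).toEmbedding)).map (restr K L a) := by
      rw [relComponents, pullBlock_map, List.map_map]
      exact List.map_congr_left fun C _ => restr_st L a U C
    rw [relTerm, h₃, ← h₁, ← h₄, restr_st, ← onlyIf_and]
    exact onlyIf_congr and_comm rfl

end Decorated

/-! ### Iterated coproducts as sums over chains of subsets -/

section Unshuffle

variable {K : Type*} [Field K] {A : Type*} [Ring A] [Algebra K A] {n : ℕ}

theorem extendMul_restr (L : NC n) (a : Fin n → A) (U : Finset (Fin n)) :
    extendMul (coprodNCA K A anySubset) (restr K L a U) =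
      ∑ T ∈ U.powerset, relTerm L a U T := by
  by_cases hU : U.Nonempty
  · rw [restr_of_nonempty L a hU, extendMul_ι]
    have h := coprodNCA_restr (K := K) (fun _ => True) L a hU (U.min'_mem hU)
      (fun x hx => U.min'_le x hx)
    simp only [onlyIf_pos] at h
    exact h
  · rw [Finset.not_nonempty_iff_eq_empty] at hU
    subst hU
    -- For empty U the letter is the unit, and the single term T = ∅ must reproduce Δ(1) = 1 ⊗ 1.
    have h : relComponents (∅ : Finset (Fin n)) ∅ = [] :=
      List.eq_nil_iff_forall_not_mem.2 fun J hJ => by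
        obtain ⟨i, hi, -⟩ := mem_relComponents_iff.1 hJ
        simp at hi
    have h' : RelCompat L ∅ ∅ := fun p hp => by simp at hp
    rw [restr_empty, map_one, Finset.powerset_empty, Finset.sum_singleton, relTerm, onlyIf_pos h', h,
      restr_empty]
    rfl

theorem extendHalf_restr_mul (c : Prop → Prop) (L : NC n) (a : Fin n → A) {U : Finset (Fin n)}
    {m : Fin n} (hm : m ∈ U) (hmin : ∀ x ∈ U, m ≤ x) (x : TensorAlgebra K (NCA K A)) :
    extendHalf (coprodNCA K A (firstCond c)) (coprodNCA K A anySubset) (restr K L a U * x) =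
      (∑ T ∈ U.powerset, onlyIf (c (m ∈ T)) (relTerm L a U T)) *
        extendMul (coprodNCA K A anySubset) x := by
  rw [restr_of_nonempty L a ⟨m, hm⟩, extendHalf_ι_mul, coprodNCA_restr c L a ⟨m, hm⟩ hm hmin]

theorem prod_restr_filter (L : NC n) (a : Fin n → A) (l : List (Finset (Fin n))) :
    ((l.filter fun J => J.Nonempty).map (restr K L a)).prod = (l.map (restr K L a)).prod := by
  induction l with
  | nil => rfl
  | cons J l ih =>
    by_cases hJ : J.Nonempty
    · rw [List.filter_cons_of_pos (by simpa using hJ), List.map_cons, List.prod_cons, ih,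
        List.map_cons, List.prod_cons]
    · rw [List.filter_cons_of_neg (by simpa using hJ), List.map_cons, List.prod_cons, ih]
      rw [Finset.not_nonempty_iff_eq_empty] at hJ
      rw [hJ, restr_empty, one_mul]

theorem prod_map_flatMap {ι κ B : Type*} [Monoid B] (f : κ → B) (g : ι → List κ) (l : List ι) :
    ((l.flatMap g).map f).prod = (l.map fun i => ((g i).map f).prod).prod := by
  induction l with
  | nil => rfl
  | cons i l ih => simp [ih]

/-- Choosing T inside each component J of the complement of S amounts to choosing S' ⊇ S, with T =
S' ∩ J. The condition c is attached only to the component containing z. If z lies in S no component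
carries it, which is why c must then hold unconditionally. -/
theorem prod_sum_relTerm (z : Fin n) (L : NC n) (a : Fin n → A) (S : Finset (Fin n))
    (c : Prop → Prop) (hc : z ∉ S ∨ ∀ p, c p) :
    ((components S).map fun J =>
      ∑ T ∈ J.powerset, onlyIf (z ∈ J → c (z ∈ T)) (relTerm (K := K) L a J T)).prod =
    ∑ S' : Finset (Fin n),
      onlyIf (S ⊆ S' ∧ (∀ J ∈ components S, RelCompat L J S') ∧ c (z ∈ S'))
        (((relComponents S' S).map (restr K L a)).prod ⊗ₜ
          ((components S').map (restr K L a)).prod) := by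
  have hU : listUnion id (components S) = Sᶜ := by
    ext j
    rw [mem_listUnion, Finset.mem_compl]
    exact exists_mem_components_iff S j
  refine (prod_sum_powerset id (fun J T => onlyIf (z ∈ J → c (z ∈ T))
    (relTerm (K := K) L a J T)) (components S) (components_pairwise S)).trans ?_
  rw [hU, sum_powerset_compl]
  refine Finset.sum_congr rfl fun S' _ => ?_
  by_cases hS : S ⊆ S'
  swap
  · rw [onlyIf_neg hS, onlyIf_neg fun h => hS h.1]
  rw [onlyIf_pos hS]
  have hmap : ((components S).map fun J => onlyIf (z ∈ J → c (z ∈ (S' \ S) ∩ id J))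
      (relTerm (K := K) L a J ((S' \ S) ∩ id J))) =
      (components S).map fun J => onlyIf ((z ∈ J → c (z ∈ S')) ∧ RelCompat L J S')
        (restr K L a (S' ∩ J) ⊗ₜ[K] ((relComponents J S').map (restr K L a)).prod) := by
    refine List.map_congr_left fun J hJ => ?_
    -- A component J avoids S, so removing S from S' changes nothing inside J.
    have hJS : (S' \ S) ∩ id J = S' ∩ J := by
      ext x
      have : x ∈ J → x ∉ S := fun hx => (exists_mem_components_iff S x).1 ⟨J, hJ, hx⟩
      simp only [id, Finset.mem_inter, Finset.mem_sdiff]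
      tauto
    have hz : (z ∈ J → c (z ∈ S' ∩ J)) ↔ (z ∈ J → c (z ∈ S')) :=
      forall_congr' fun h => by simp [h]
    rw [hJS, relTerm, relCompat_inter, relComponents_inter, hz, ← onlyIf_and]
  rw [hmap, prod_map_onlyIf, prod_map_tmul]
  refine onlyIf_congr ?_ ?_
  · constructor
    · intro h
      refine ⟨hS, fun J hJ => (h J hJ).2, ?_⟩
      rcases hc with hz | hc
      · obtain ⟨J, hJ, hzJ⟩ := (exists_mem_components_iff S z).2 hz
        exact (h J hJ).1 hzJ
      · exact hc _
    · exact fun h J hJ => ⟨fun _ => h.2.2, h.2.1 J hJ⟩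
  · congr 1
    · rw [relComponents_eq_filter hS, prod_restr_filter, List.map_map]
      rfl
    · rw [components_eq_flatMap hS, prod_map_flatMap]

theorem extendMul_prod_restr (z : Fin n) (L : NC n) (a : Fin n → A) (S : Finset (Fin n)) :
    extendMul (coprodNCA K A anySubset) ((components S).map (restr K L a)).prod =
    ∑ S' : Finset (Fin n),
      onlyIf (S ⊆ S' ∧ (∀ J ∈ components S, RelCompat L J S') ∧ True)
        (((relComponents S' S).map (restr K L a)).prod ⊗ₜ
          ((components S').map (restr K L a)).prod) := by
  rw [← prod_sum_relTerm z L a S (fun _ => True) (Or.inr fun _ => trivial), map_list_prod,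
    List.map_map]
  congr 1
  refine List.map_congr_left fun J _ => ?_
  simp [extendMul_restr, onlyIf]

/-- When the first element is not in S it lies in the leftmost component, which is precisely the
letter on which a half-coproduct imposes its condition. -/
theorem extendHalf_prod_restr (h : 0 < n) (L : NC n) (a : Fin n → A) {S : Finset (Fin n)}
    (hS : (⟨0, h⟩ : Fin n) ∉ S) (c : Prop → Prop) :
    extendHalf (coprodNCA K A (firstCond c)) (coprodNCA K A anySubset)
      ((components S).map (restr K L a)).prod =
    ∑ S' : Finset (Fin n),
      onlyIf (S ⊆ S' ∧ (∀ J ∈ components S, RelCompat L J S') ∧ c ((⟨0, h⟩ : Fin n) ∈ S'))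
        (((relComponents S' S).map (restr K L a)).prod ⊗ₜ
          ((components S').map (restr K L a)).prod) := by
  rw [← prod_sum_relTerm ⟨0, h⟩ L a S c (Or.inl hS)]
  have hmin : ∀ x : Fin n, (⟨0, h⟩ : Fin n) ≤ x := fun x => Fin.mk_le_of_le_val (Nat.zero_le _)
  obtain ⟨J, hJ, hzJ⟩ := (exists_mem_components_iff S ⟨0, h⟩).2 hS
  have hb := components_pairwise_before S
  have hd := components_pairwise S
  have hne : ∀ J ∈ components S, J.Nonempty := fun J => nonempty_of_mem_components
  generalize components S = l at hJ hb hd hne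
  cases l with
  | nil => simp at hJ
  | cons J₁ l =>
    rw [List.pairwise_cons] at hb hd
    -- Any later component lies to the right of the non-empty J₁, so it cannot contain the least
    -- element.
    have hz₁ : (⟨0, h⟩ : Fin n) ∈ J₁ := by
      rcases List.mem_cons.1 hJ with rfl | hJ
      · exact hzJ
      · obtain ⟨x, hx⟩ := hne J₁ List.mem_cons_self
        exact absurd (hb.1 J hJ x hx _ hzJ) (not_lt.2 (hmin x))
    rw [List.map_cons, List.prod_cons, List.map_cons, List.prod_cons,
      extendHalf_restr_mul c L a hz₁ fun x _ => hmin x, map_list_prod, List.map_map]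
    congr 1
    · simp [hz₁]
    · congr 1
      refine List.map_congr_left fun J' hJ' => ?_
      have : (⟨0, h⟩ : Fin n) ∉ J' := Finset.disjoint_left.1 (hd.1 J' hJ') hz₁
      simp [extendMul_restr, onlyIf, this]

/-- The sum of the terms of the iterated coproduct of `L ⊗ a` indexed by the chains `S ⊆ S'`
that satisfy the condition `c`. -/
noncomputable def chainSum (K : Type*) [Field K] {A : Type*} [Ring A] [Algebra K A]
    (L : NC n) (a : Fin n → A) (c : Finset (Fin n) → Finset (Fin n) → Prop) :
    TensorAlgebra K (NCA K A) ⊗[K] (TensorAlgebra K (NCA K A) ⊗[K] TensorAlgebra K (NCA K A)) :=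
  ∑ S : Finset (Fin n), ∑ S' : Finset (Fin n),
    onlyIf (S ⊆ S' ∧ Compat L S ∧ (∀ J ∈ components S, RelCompat L J S') ∧ c S S')
      (restr K L a S ⊗ₜ (((relComponents S' S).map (restr K L a)).prod ⊗ₜ
        ((components S').map (restr K L a)).prod))

theorem chainSum_congr (L : NC n) (a : Fin n → A) {c c' : Finset (Fin n) → Finset (Fin n) → Prop}
    (h : ∀ S S', S ⊆ S' → (c S S' ↔ c' S S')) : chainSum K L a c = chainSum K L a c' := by
  refine Finset.sum_congr rfl fun S _ => Finset.sum_congr rfl fun S' _ => ?_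
  refine onlyIf_congr (and_congr_right fun hS => ?_) rfl
  rw [h S S' hS]

set_option maxHeartbeats 1000000 in
-- Here the outer splitting chooses S' and D then splits S' by S. With `lTensor_coprodNCA`, where S
-- is chosen first, each unshuffle identity reduces to comparing two conditions on the position of
-- the first element relative to S ⊆ S'.
theorem assoc_rTensor_coprodNCA (D : TensorAlgebra K (NCA K A) →ₗ[K]
      TensorAlgebra K (NCA K A) ⊗[K] TensorAlgebra K (NCA K A))
    (h : 0 < n) (L : NC n) (a : Fin n → A) (p c : Prop → Prop)
    (hD : ∀ S' : Finset (Fin n), p ((⟨0, h⟩ : Fin n) ∈ S') → D (restr K L a S') =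
      ∑ S ∈ S'.powerset, onlyIf (c ((⟨0, h⟩ : Fin n) ∈ S)) (relTerm L a S' S)) :
    TensorProduct.assoc K _ _ _ (D.rTensor (TensorAlgebra K (NCA K A))
      (coprodNCA K A (firstCond p) (decorated K A h L a))) =
    chainSum K L a fun S S' => p ((⟨0, h⟩ : Fin n) ∈ S') ∧ c ((⟨0, h⟩ : Fin n) ∈ S) := by
  rw [coprodNCA_decorated, map_sum, map_sum, chainSum, Finset.sum_comm]
  refine Finset.sum_congr rfl fun S' _ => ?_
  by_cases hS' : Compat L S' ∧ firstCond p ⟨n, h⟩ S'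
  · rw [onlyIf_pos hS', LinearMap.rTensor_tmul, hD S' hS'.2, TensorProduct.sum_tmul, map_sum,
      -- The terms of the chain sum with S not contained in S' vanish, so the sum over all S may be
      -- cut down to subsets of S'.
      ← Finset.sum_subset (Finset.subset_univ S'.powerset)]
    · refine Finset.sum_congr rfl fun S hS => ?_
      rw [Finset.mem_powerset] at hS
      have hch := compat_chain (L := L) hS
      have hp : p ((⟨0, h⟩ : Fin n) ∈ S') := hS'.2
      by_cases hc : c ((⟨0, h⟩ : Fin n) ∈ S)
      · by_cases hR : RelCompat L S' S
        · have := hch.1 ⟨hS'.1, hR⟩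
          rw [onlyIf_pos hc, relTerm, onlyIf_pos hR, onlyIf_pos ⟨hS, this.1, this.2, hp, hc⟩,
            TensorProduct.assoc_tmul]
        · rw [onlyIf_pos hc, relTerm, onlyIf_neg hR, TensorProduct.zero_tmul, LinearEquiv.map_zero]
          exact (onlyIf_neg fun H => hR (hch.2 ⟨H.2.1, H.2.2.1⟩).2).symm
      · rw [onlyIf_neg hc, TensorProduct.zero_tmul, LinearEquiv.map_zero]
        exact (onlyIf_neg fun H => hc H.2.2.2.2).symm
    · intro S _ hS
      rw [Finset.mem_powerset] at hS
      exact onlyIf_neg fun H => hS H.1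
  · rw [onlyIf_neg hS', LinearMap.map_zero, LinearEquiv.map_zero]
    refine (Finset.sum_eq_zero fun S _ => ?_).symm
    rw [onlyIf_neg]
    rintro ⟨hS, h₁, h₂, h₃, -⟩
    exact hS' ⟨((compat_chain hS).2 ⟨h₁, h₂⟩).1, h₃⟩

theorem lTensor_coprodNCA (D : TensorAlgebra K (NCA K A) →ₗ[K]
      TensorAlgebra K (NCA K A) ⊗[K] TensorAlgebra K (NCA K A))
    (h : 0 < n) (L : NC n) (a : Fin n → A) (p c : Prop → Prop)
    (hD : ∀ S : Finset (Fin n), p ((⟨0, h⟩ : Fin n) ∈ S) →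
      D ((components S).map (restr K L a)).prod = ∑ S' : Finset (Fin n),
      onlyIf (S ⊆ S' ∧ (∀ J ∈ components S, RelCompat L J S') ∧ c ((⟨0, h⟩ : Fin n) ∈ S'))
        (((relComponents S' S).map (restr K L a)).prod ⊗ₜ
          ((components S').map (restr K L a)).prod)) :
    D.lTensor (TensorAlgebra K (NCA K A))
      (coprodNCA K A (firstCond p) (decorated K A h L a)) =
    chainSum K L a fun S S' => p ((⟨0, h⟩ : Fin n) ∈ S) ∧ c ((⟨0, h⟩ : Fin n) ∈ S') := by
  rw [coprodNCA_decorated, map_sum, chainSum]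
  refine Finset.sum_congr rfl fun S _ => ?_
  by_cases hS : Compat L S ∧ firstCond p ⟨n, h⟩ S
  · rw [onlyIf_pos hS, LinearMap.lTensor_tmul, hD S hS.2, TensorProduct.tmul_sum]
    refine Finset.sum_congr rfl fun S' _ => ?_
    have hp : p ((⟨0, h⟩ : Fin n) ∈ S) := hS.2
    have hL := hS.1
    by_cases hc : S ⊆ S' ∧ (∀ J ∈ components S, RelCompat L J S') ∧
        c ((⟨0, h⟩ : Fin n) ∈ S')
    · rw [onlyIf_pos hc, onlyIf_pos ⟨hc.1, hL, hc.2.1, hp, hc.2.2⟩]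
    · rw [onlyIf_neg hc, onlyIf_neg fun H => hc ⟨H.1, H.2.2.1, H.2.2.2.2⟩,
        TensorProduct.tmul_zero]
  · rw [onlyIf_neg hS, map_zero]
    refine (Finset.sum_eq_zero fun S' _ => ?_).symm
    rw [onlyIf_neg]
    rintro ⟨-, h₁, -, h₂, -⟩
    exact hS ⟨h₁, h₂⟩

theorem coprodNCA_eq_add (v : NCA K A) :
    coprodNCA K A anySubset v = coprodNCA K A hasFirst v + coprodNCA K A lacksFirst v := by
  induction v using NCA.induction with
  | zero => simp
  | add x y hx hy => rw [map_add, hx, hy, map_add, map_add]; abel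
  | smul c x hx => rw [map_smul, hx, map_smul, map_smul, smul_add]
  | decorated n h L a =>
    rw [coprodNCA_decorated, coprodNCA_decorated, coprodNCA_decorated, ← Finset.sum_add_distrib]
    refine Finset.sum_congr rfl fun S _ => ?_
    simp only [anySubset, hasFirst, lacksFirst]
    by_cases hL : Compat L S
    · by_cases hS : (⟨0, h⟩ : Fin n) ∈ S
      · rw [onlyIf_pos ⟨hL, trivial⟩, onlyIf_pos ⟨hL, hS⟩, onlyIf_neg fun H => H.2 hS, add_zero]
      · rw [onlyIf_pos ⟨hL, trivial⟩, onlyIf_neg fun H => hS H.2, onlyIf_pos ⟨hL, hS⟩, zero_add]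
    · rw [onlyIf_neg fun H => hL H.1, onlyIf_neg fun H => hL H.1, onlyIf_neg fun H => hL H.1,
        add_zero]

theorem coprodNCA_hasFirst_mem (v : NCA K A) :
    coprodNCA K A hasFirst v ∈ leftLetters K (NCA K A) := by
  induction v using NCA.induction with
  | zero => simp
  | add x y hx hy => rw [map_add]; exact Submodule.add_mem _ hx hy
  | smul c x hx => rw [map_smul]; exact Submodule.smul_mem _ _ hx
  | decorated n h L a =>
    rw [coprodNCA_decorated]
    refine Submodule.sum_mem _ fun S _ => ?_
    by_cases hS : Compat L S ∧ hasFirst ⟨n, h⟩ S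
    · rw [onlyIf_pos hS]
      have hne : S.Nonempty := ⟨_, hS.2⟩
      rw [restr_of_nonempty L a hne]
      exact Submodule.subset_span ⟨_, _, rfl⟩
    · rw [onlyIf_neg hS]
      exact Submodule.zero_mem _

theorem coprodNCA_lacksFirst_mem (v : NCA K A) :
    coprodNCA K A lacksFirst v ∈ rightWords K (NCA K A) := by
  induction v using NCA.induction with
  | zero => simp
  | add x y hx hy => rw [map_add]; exact Submodule.add_mem _ hx hy
  | smul c x hx => rw [map_smul]; exact Submodule.smul_mem _ _ hx
  | decorated n h L a =>
    rw [coprodNCA_decorated]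
    refine Submodule.sum_mem _ fun S _ => ?_
    by_cases hS : Compat L S ∧ lacksFirst ⟨n, h⟩ S
    · rw [onlyIf_pos hS]
      obtain ⟨J, hJ, -⟩ := (exists_mem_components_iff S ⟨0, h⟩).2 hS.2
      have hne : ∀ J ∈ components S, J.Nonempty := fun J => nonempty_of_mem_components
      generalize components S = l at hJ hne
      cases l with
      | nil => simp at hJ
      | cons J₁ l =>
        rw [List.map_cons, List.prod_cons, restr_of_nonempty L a (hne J₁ List.mem_cons_self)]
        exact Submodule.subset_span ⟨_, _, _, rfl⟩
    · rw [onlyIf_neg hS]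
      exact Submodule.zero_mem _

theorem firstCond_id : firstCond id = hasFirst := rfl

theorem firstCond_not : firstCond Not = lacksFirst := rfl

variable (K A) in
theorem isUnshuffle_coprodNCA :
    IsUnshuffle (coprodNCA K A hasFirst) (coprodNCA K A lacksFirst)
      (coprodNCA K A anySubset) where
  eq_add := coprodNCA_eq_add
  left_mem := coprodNCA_hasFirst_mem
  right_mem := coprodNCA_lacksFirst_mem
  left_left v := by
    induction v using NCA.induction with
    | zero => simp
    | add x y hx hy => simp only [map_add, hx, hy]
    | smul c x hx => simp only [map_smul, hx]
    | decorated n h L a =>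
      have hmin : ∀ x : Fin n, (⟨0, h⟩ : Fin n) ≤ x := fun x => Fin.mk_le_of_le_val (Nat.zero_le _)
      rw [← firstCond_id, assoc_rTensor_coprodNCA _ h L a id id fun S' hS' => by
          simpa using extendHalf_restr_mul id L a hS' (fun x _ => hmin x) 1,
        lTensor_coprodNCA _ h L a id (fun _ => True) fun S _ => extendMul_prod_restr ⟨0, h⟩ L a S]
      -- Both sides describe the chains with 1 ∈ S, since this already implies 1 ∈ S'.
      exact chainSum_congr L a fun S S' hS => ⟨fun H => ⟨H.2, trivial⟩, fun H => ⟨hS H.1, H.1⟩⟩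
  right_left v := by
    induction v using NCA.induction with
    | zero => simp
    | add x y hx hy => simp only [map_add, hx, hy]
    | smul c x hx => simp only [map_smul, hx]
    | decorated n h L a =>
      have hmin : ∀ x : Fin n, (⟨0, h⟩ : Fin n) ≤ x := fun x => Fin.mk_le_of_le_val (Nat.zero_le _)
      rw [← firstCond_id, ← firstCond_not,
        assoc_rTensor_coprodNCA _ h L a id Not fun S' hS' => by
          simpa using extendHalf_restr_mul Not L a hS' (fun x _ => hmin x) 1,
        lTensor_coprodNCA _ h L a Not id fun S hS => extendHalf_prod_restr h L a hS id]
      -- Both sides describe the chains with 1 ∈ S' \ S.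
      exact chainSum_congr L a fun S S' _ => and_comm
  right_right v := by
    induction v using NCA.induction with
    | zero => simp
    | add x y hx hy => simp only [map_add, hx, hy]
    | smul c x hx => simp only [map_smul, hx]
    | decorated n h L a =>
      rw [← firstCond_not,
        assoc_rTensor_coprodNCA _ h L a Not (fun _ => True) fun S' _ => by
          simpa [onlyIf] using extendMul_restr (K := K) L a S',
        lTensor_coprodNCA _ h L a Not Not fun S hS => extendHalf_prod_restr h L a hS Not]
      -- Both sides describe the chains with 1 ∉ S', since this already implies 1 ∉ S.
      exact chainSum_congr L a fun S S' hS =>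
        ⟨fun H => ⟨fun h' => H.1 (hS h'), H.1⟩, fun H => ⟨H.2, trivial⟩⟩

end Unshuffle

/-! ### Gluing non-crossing partitions along a subset and its components -/

section Gluing

variable {n : ℕ}

/-- The discrete set partition, with all blocks of size one. -/
def NC.discrete (n : ℕ) : NC n :=
  ⟨⊥, by
    rintro ⟨p₁, q₁, p₂, q₂, h₁, h₂, -, ⟨B, hB, hp₁, hp₂⟩, -⟩
    obtain ⟨x, -, rfl⟩ := Finpartition.mem_bot_iff.1 hB
    rw [Finset.mem_singleton] at hp₁ hp₂
    subst hp₁ hp₂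
    exact absurd (h₁.trans h₂) (lt_irrefl _)⟩

/-- The relation `R` induces on the subset `U` the set partition `M`. -/
def Induces (U : Finset (Fin n)) (R : Finset (Fin n × Fin n)) (M : NC U.card) : Prop :=
  ∀ i j, SameBlock M.1 i j ↔ (incl U i, incl U j) ∈ R

open Classical in
/-- The graph of the equivalence relation associated with a set partition. -/
noncomputable def graphOf (L : NC n) : Finset (Fin n × Fin n) :=
  Finset.univ.filter fun p => SameBlock L.1 p.1 p.2

theorem mem_graphOf {L : NC n} {p q : Fin n} : (p, q) ∈ graphOf L ↔ SameBlock L.1 p q := by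
  simp [graphOf]

theorem graphOf_injective : Function.Injective (graphOf (n := n)) := fun L M h =>
  NC.ext_sameBlock fun p q => by rw [← mem_graphOf, h, mem_graphOf]

theorem induces_graphOf_iff {L : NC n} {U : Finset (Fin n)} {M : NC U.card} :
    Induces U (graphOf L) M ↔ M = L.st U := by
  constructor
  · intro h
    refine NC.ext_sameBlock fun i j => ?_
    rw [h i j, mem_graphOf]
    exact (sameBlock_stdRestrict L.1 U i j).symm
  · rintro rfl i j
    rw [mem_graphOf]
    exact sameBlock_stdRestrict L.1 U i j

theorem induces_inter {U : Finset (Fin n)} {R : Finset (Fin n × Fin n)} {M : NC U.card} :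
    Induces U (R ∩ U ×ˢ U) M ↔ Induces U R M := by
  refine forall₂_congr fun i j => iff_congr Iff.rfl ?_
  rw [Finset.mem_inter, Finset.mem_product]
  exact and_iff_left ⟨incl_mem U i, incl_mem U j⟩

/-- A partition of U is encoded by its graph inside U × U. Sums over partitions become sums over
subsets of U × U, so families of partitions of disjoint sets fall under `prod_sum_powerset`. -/
theorem exists_unique_induces (U : Finset (Fin n)) (M : NC U.card) :
    ∃ R ∈ (U ×ˢ U).powerset, ∀ R' ∈ (U ×ˢ U).powerset, Induces U R' M ↔ R' = R := by
  have hmem : ∀ i j, (incl U i, incl U j) ∈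
      (graphOf M).map ((incl U).toEmbedding.prodMap (incl U).toEmbedding) ↔
        SameBlock M.1 i j := by
    intro i j
    rw [← mem_graphOf]
    exact Finset.mem_map' ((incl U).toEmbedding.prodMap (incl U).toEmbedding) (a := (i, j))
  have hsub : (graphOf M).map ((incl U).toEmbedding.prodMap (incl U).toEmbedding) ⊆ U ×ˢ U := by
    intro x hx
    obtain ⟨y, -, rfl⟩ := Finset.mem_map.1 hx
    exact Finset.mem_product.2 ⟨incl_mem U y.1, incl_mem U y.2⟩
  refine ⟨_, Finset.mem_powerset.2 hsub, fun R' hR' => ⟨fun h => ?_, ?_⟩⟩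
  · rw [Finset.mem_powerset] at hR'
    have key : ∀ p q, p ∈ U → q ∈ U → ((p, q) ∈ R' ↔ (p, q) ∈
        (graphOf M).map ((incl U).toEmbedding.prodMap (incl U).toEmbedding)) := by
      intro p q hp hq
      obtain ⟨i, rfl⟩ := exists_incl_eq hp
      obtain ⟨j, rfl⟩ := exists_incl_eq hq
      rw [hmem, h i j]
    ext ⟨p, q⟩
    constructor
    · intro hpq
      have := Finset.mem_product.1 (hR' hpq)
      exact (key p q this.1 this.2).1 hpq
    · intro hpq
      have := Finset.mem_product.1 (hsub hpq)
      exact (key p q this.1 this.2).2 hpq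
  · rintro rfl i j
    exact (hmem i j).symm

/-- The pairs of elements that lie both in `S` or in the same connected component of the
complement of `S`. -/
def sameSide (S : Finset (Fin n)) : Finset (Fin n × Fin n) :=
  S ×ˢ S ∪ listUnion (fun J => J ×ˢ J) (components S)

theorem mem_sameSide {S : Finset (Fin n)} {p q : Fin n} :
    (p, q) ∈ sameSide S ↔ (p ∈ S ∧ q ∈ S) ∨ q ∈ component S p := by
  rw [sameSide, Finset.mem_union, Finset.mem_product, mem_listUnion]
  refine or_congr Iff.rfl ?_
  constructor
  · rintro ⟨J, hJ, hpq⟩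
    obtain ⟨i, -, rfl⟩ := mem_components_iff.1 hJ
    rw [Finset.mem_product] at hpq
    rw [component_eq_of_mem hpq.1]
    exact hpq.2
  · intro hq
    have hp : p ∉ S := notMem_of_mem_component (mem_component_comm.1 hq)
    exact ⟨_, mem_components_iff.2 ⟨p, hp, rfl⟩,
      Finset.mem_product.2 ⟨self_mem_component hp, hq⟩⟩

theorem compat_iff_graphOf_subset {L : NC n} {S : Finset (Fin n)} :
    Compat L S ↔ graphOf L ⊆ sameSide S := by
  constructor
  · rintro h ⟨p, q⟩ hpq
    exact mem_sameSide.2 (h p q (mem_graphOf.1 hpq))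
  · intro h p q hpq
    exact mem_sameSide.1 (h (mem_graphOf.2 hpq))

theorem SameBlock.symm {L : Finpartition (Finset.univ : Finset (Fin n))} {p q : Fin n}
    (h : SameBlock L p q) : SameBlock L q p := by
  obtain ⟨B, hB, hp, hq⟩ := h
  exact ⟨B, hB, hq, hp⟩

theorem SameBlock.trans {L : Finpartition (Finset.univ : Finset (Fin n))} {p q r : Fin n}
    (h : SameBlock L p q) (h' : SameBlock L q r) : SameBlock L p r := by
  obtain ⟨B, hB, hp, hq⟩ := h
  exact ⟨B, hB, hp, eq_of_sameBlock hB hq h'⟩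

theorem sameBlock_refl (L : Finpartition (Finset.univ : Finset (Fin n))) (p : Fin n) :
    SameBlock L p p :=
  ⟨L.part p, L.part_mem.2 (Finset.mem_univ p), L.mem_part (Finset.mem_univ p),
    L.mem_part (Finset.mem_univ p)⟩

theorem exists_finpartition_of_equivalence {r : Fin n → Fin n → Prop} (h : Equivalence r) :
    ∃ L : Finpartition (Finset.univ : Finset (Fin n)), ∀ p q, SameBlock L p q ↔ r p q := by
  classical
  let s : Setoid (Fin n) := ⟨r, h⟩
  refine ⟨Finpartition.ofSetoid s, fun p q => ?_⟩
  rw [sameBlock_iff_mem_part, Finpartition.mem_part_ofSetoid_iff_rel]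
  rfl

/-- The relation R never links distinct pieces among S and its components, so it is an equivalence
because it is one on each piece. A crossing cannot involve two pieces, since components are
intervals avoiding S, and it cannot occur within one piece by assumption. -/
theorem exists_graphOf_eq {S : Finset (Fin n)} {R : Finset (Fin n × Fin n)}
    (hR : R ⊆ sameSide S) (hS : ∃ M, Induces S R M)
    (hJ : ∀ J ∈ components S, ∃ M, Induces J R M) : ∃ L, graphOf L = R := by
  -- U is the piece containing p; everything that R relates to p stays in it.
  have cover : ∀ p : Fin n, ∃ U, p ∈ U ∧ (∃ M, Induces U R M) ∧
      ∀ q, (p, q) ∈ sameSide S → q ∈ U := by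
    intro p
    by_cases hp : p ∈ S
    · refine ⟨S, hp, hS, fun q hq => ?_⟩
      rcases mem_sameSide.1 hq with h | h
      · exact h.2
      · exact absurd hp (notMem_of_mem_component (mem_component_comm.1 h))
    · refine ⟨component S p, self_mem_component hp, hJ _ (mem_components_iff.2 ⟨p, hp, rfl⟩),
        fun q hq => ?_⟩
      rcases mem_sameSide.1 hq with h | h
      · exact absurd h.1 hp
      · exact h
  have hside : ∀ {p q}, (p, q) ∈ R → (p, q) ∈ sameSide S := fun h => hR h
  have hrefl : ∀ p, (p, p) ∈ R := by
    intro p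
    obtain ⟨U, hpU, ⟨M, hM⟩, -⟩ := cover p
    obtain ⟨i, rfl⟩ := exists_incl_eq hpU
    exact (hM i i).1 (sameBlock_refl M.1 i)
  have hsymmR : ∀ {p q}, (p, q) ∈ R → (q, p) ∈ R := by
    intro p q h
    obtain ⟨U, hpU, ⟨M, hM⟩, hU⟩ := cover p
    obtain ⟨j, rfl⟩ := exists_incl_eq (hU q (hside h))
    obtain ⟨i, rfl⟩ := exists_incl_eq hpU
    exact (hM j i).1 ((hM i j).2 h).symm
  have htrans : ∀ {p q r}, (p, q) ∈ R → (q, r) ∈ R → (p, r) ∈ R := by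
    intro p q r h h'
    obtain ⟨U, hqU, ⟨M, hM⟩, hU⟩ := cover q
    obtain ⟨i, rfl⟩ := exists_incl_eq (hU p (hside (hsymmR h)))
    obtain ⟨k, rfl⟩ := exists_incl_eq (hU r (hside h'))
    obtain ⟨j, rfl⟩ := exists_incl_eq hqU
    exact (hM i k).1 (((hM i j).2 h).trans ((hM j k).2 h'))
  obtain ⟨L, hL⟩ := exists_finpartition_of_equivalence (r := fun p q => (p, q) ∈ R)
    ⟨hrefl, hsymmR, htrans⟩
  have hNC : IsNonCrossing L := by
    rintro ⟨p₁, q₁, p₂, q₂, h₁, h₂, h₃, h₄, h₅, h₆⟩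
    rw [hL] at h₄ h₅ h₆
    -- The two linked pairs of a crossing share a piece. If p₁, p₂ lie in a component, it contains
    -- q₁, which is between them; if p₁, p₂ lie in S and q₁, q₂ in a component, then p₂ in S would
    -- separate q₁ from q₂.
    have hpq : (p₁, q₁) ∈ sameSide S := by
      have hp := mem_sameSide.1 (hside h₄)
      have hq := mem_sameSide.1 (hside h₆)
      rw [mem_sameSide]
      rcases hp with hp | hp
      · rcases hq with hq | hq
        · exact Or.inl ⟨hp.1, hq.1⟩
        · refine absurd hp.2 (mem_component.1 hq p₂ ?_)
          rw [Finset.uIcc_of_le (h₂.trans h₃).le, Finset.mem_Icc]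
          exact ⟨h₂.le, h₃.le⟩
      · refine Or.inr (mem_component.2 fun k hk => mem_component.1 hp k ?_)
        rw [Finset.uIcc_of_le h₁.le, Finset.mem_Icc] at hk
        rw [Finset.uIcc_of_le (h₁.trans h₂).le, Finset.mem_Icc]
        exact ⟨hk.1, hk.2.trans h₂.le⟩
    obtain ⟨U, hpU, ⟨M, hM⟩, hU⟩ := cover p₁
    have hqU := hU _ hpq
    have hpU' := hU _ (hside h₄)
    have hqU' : q₂ ∈ U := by
      have hmem : ∀ {x y z}, (x, y) ∈ sameSide S → (y, z) ∈ sameSide S →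
          (x, z) ∈ sameSide S := by
        intro x y z hxy hyz
        rw [mem_sameSide] at *
        rcases hxy with hxy | hxy
        · rcases hyz with hyz | hyz
          · exact Or.inl ⟨hxy.1, hyz.2⟩
          · exact absurd hxy.2 (mem_component.1 hyz y Finset.left_mem_uIcc)
        · rcases hyz with hyz | hyz
          · exact absurd hyz.1 (notMem_of_mem_component hxy)
          · rw [component_eq_of_mem hxy] at hyz
            exact Or.inr hyz
      exact hU _ (hmem hpq (hside h₆))
    obtain ⟨i₁, rfl⟩ := exists_incl_eq hpU
    obtain ⟨i₂, rfl⟩ := exists_incl_eq hpU'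
    obtain ⟨j₁, rfl⟩ := exists_incl_eq hqU
    obtain ⟨j₂, rfl⟩ := exists_incl_eq hqU'
    rw [← hM] at h₄ h₅ h₆
    rw [OrderEmbedding.lt_iff_lt] at h₁ h₂ h₃
    exact M.2 ⟨i₁, j₁, i₂, j₂, h₁, h₂, h₃, h₄, h₅, h₆⟩
  refine ⟨⟨L, hNC⟩, ?_⟩
  ext ⟨p, q⟩
  exact mem_graphOf.trans (hL p q)

end Gluing

/-! ### The splitting map intertwines the coproducts -/

section SplittingMap

variable {K : Type*} [Field K] {A : Type*} [Ring A] [Algebra K A]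

variable (K A) in
/-- The word `a` as an element of `T(A)`. -/
noncomputable def word {n : ℕ} (h : 0 < n) (a : Fin n → A) : TA K A :=
  DirectSum.lof K ℕ+ (fun n => ⨂[K]^(n : ℕ) A) ⟨n, h⟩ (PiTensorProduct.tprod K a)

theorem TA.induction {P : TA K A → Prop} (zero : P 0) (add : ∀ x y, P x → P y → P (x + y))
    (smul : ∀ (c : K) x, P x → P (c • x))
    (word : ∀ (n : ℕ) (h : 0 < n) (a : Fin n → A), P (word K A h a)) (x : TA K A) : P x := by
  induction x using DirectSum.induction_on with
  | zero => exact zero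
  | add x y hx hy => exact add x y hx hy
  | of n w =>
    change P (DirectSum.lof K ℕ+ (fun n => ⨂[K]^(n : ℕ) A) n w)
    induction w using PiTensorProduct.induction_on with
    | smul_tprod r a =>
      rw [map_smul]
      exact smul _ _ (word n n.pos a)
    | add x y hx hy => rw [map_add]; exact add _ _ hx hy

theorem coprodTA_word (p : SubsetCond) {n : ℕ} (h : 0 < n) (a : Fin n → A) :
    coprodTA K A p (word K A h a) = ∑ S : Finset (Fin n), onlyIf (p ⟨n, h⟩ S)
      (letter (wordTA K A) S a ⊗ₜ ((components S).map fun J => letter (wordTA K A) J a).prod) := by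
  classical
  have key : ∀ (n : ℕ+) (a : Fin n → A), coprodTA K A p
      (DirectSum.lof K ℕ+ (fun n => ⨂[K]^(n : ℕ) A) n (PiTensorProduct.tprod K a)) =
      ∑ S : Finset (Fin n), onlyIf (p n S) (letter (wordTA K A) S a ⊗ₜ
        ((components S).map fun J => letter (wordTA K A) J a).prod) := by
    intro n a
    rw [coprodTA, DirectSum.toModule_lof, LinearMap.sum_apply, sum_onlyIf]
    simp only [splitTerm_tprod]
  exact key ⟨n, h⟩ a

theorem splitLetter_word {n : ℕ} (h : 0 < n) (a : Fin n → A) :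
    splitLetter K A (word K A h a) = ∑ L : NC n, decorated K A h L a := by
  have key : ∀ (n : ℕ+) (a : Fin n → A), splitLetter K A
      (DirectSum.lof K ℕ+ (fun n => ⨂[K]^(n : ℕ) A) n (PiTensorProduct.tprod K a)) =
      ∑ L : NC n, DirectSum.lof K ℕ+ (fun n => (NC (n : ℕ) →₀ K) ⊗[K] (⨂[K]^(n : ℕ) A)) n
        (Finsupp.single L 1 ⊗ₜ PiTensorProduct.tprod K a) := by
    intro n a
    rw [splitLetter, DirectSum.toModule_lof, LinearMap.sum_apply]
    rfl
  exact key ⟨n, h⟩ a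

variable (K) in
/-- The letter given by the subword of `a` indexed by `U`, decorated by `M`; it is the unit if
`U` is empty. -/
noncomputable def decoratedOn {n : ℕ} (a : Fin n → A) (U : Finset (Fin n)) (M : NC U.card) :
    TensorAlgebra K (NCA K A) :=
  if h : U.Nonempty then TensorAlgebra.ι K (decorated K A h.card_pos M (a ∘ incl U)) else 1

theorem decoratedOn_st {n : ℕ} (L : NC n) (a : Fin n → A) (U : Finset (Fin n)) :
    decoratedOn K a U (L.st U) = restr K L a U := by
  by_cases h : U.Nonempty
  · rw [decoratedOn, dif_pos h, restr_of_nonempty L a h]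
  · rw [decoratedOn, dif_neg h, restr, letter, dif_neg h]

theorem tensorMap_letter {n : ℕ} (a : Fin n → A) (U : Finset (Fin n)) :
    tensorMap (splitLetter K A) (letter (wordTA K A) U a) =
      ∑ M : NC U.card, decoratedOn K a U M := by
  by_cases h : U.Nonempty
  · have hw : letter (wordTA K A) U a =
        TensorAlgebra.ι K (word K A h.card_pos (a ∘ incl U)) := by
      rw [letter, dif_pos h]
      rfl
    rw [hw, tensorMap_ι, splitLetter_word, map_sum]
    exact Finset.sum_congr rfl fun M _ => by rw [decoratedOn, dif_pos h]
  · rw [letter, dif_neg h, map_one]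
    rw [Finset.not_nonempty_iff_eq_empty] at h
    subst h
    -- The empty set has exactly one partition, so the sum over decorations is the unit, as the
    -- image of the empty word must be.
    have huniq : ∀ M : NC (∅ : Finset (Fin n)).card, M = NC.discrete _ := fun M =>
      NC.ext_sameBlock fun p => p.elim0
    rw [Finset.sum_eq_single (NC.discrete _) (fun M _ hM => absurd (huniq M) hM)
      (fun h => absurd (Finset.mem_univ _) h), decoratedOn, dif_neg (by simp)]

variable (K) in
/-- The decoration of the subword of `a` indexed by `U` by the set partition induced by `R`; it
is zero if there is no such non-crossing partition. -/
noncomputable def decoratedBy {n : ℕ} (a : Fin n → A) (U : Finset (Fin n))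
    (R : Finset (Fin n × Fin n)) : TensorAlgebra K (NCA K A) :=
  ∑ M : NC U.card, onlyIf (Induces U R M) (decoratedOn K a U M)

theorem decoratedBy_inter {n : ℕ} (a : Fin n → A) (U : Finset (Fin n))
    (R : Finset (Fin n × Fin n)) : decoratedBy K a U (R ∩ U ×ˢ U) = decoratedBy K a U R :=
  Finset.sum_congr rfl fun _ _ => onlyIf_congr induces_inter rfl

theorem decoratedBy_graphOf {n : ℕ} (L : NC n) (a : Fin n → A) (U : Finset (Fin n)) :
    decoratedBy K a U (graphOf L) = restr K L a U := by
  rw [decoratedBy, Finset.sum_eq_single (L.st U), onlyIf_pos (induces_graphOf_iff.2 rfl),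
    decoratedOn_st]
  · exact fun M _ hM => onlyIf_neg fun h => hM (induces_graphOf_iff.1 h)
  · exact fun h => absurd (Finset.mem_univ _) h

theorem exists_induces_of_decoratedBy_ne_zero {n : ℕ} {a : Fin n → A} {U : Finset (Fin n)}
    {R : Finset (Fin n × Fin n)} (h : decoratedBy K a U R ≠ 0) : ∃ M, Induces U R M := by
  by_contra! hM
  exact h (Finset.sum_eq_zero fun M _ => onlyIf_neg (hM M))

theorem tensorMap_letter_eq_sum {n : ℕ} (a : Fin n → A) (U : Finset (Fin n)) :
    tensorMap (splitLetter K A) (letter (wordTA K A) U a) =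
      ∑ R ∈ (U ×ˢ U).powerset, decoratedBy K a U R := by
  simp only [tensorMap_letter, decoratedBy]
  rw [Finset.sum_comm]
  refine Finset.sum_congr rfl fun M _ => ?_
  obtain ⟨R, hR, h⟩ := exists_unique_induces U M
  rw [Finset.sum_eq_single R, onlyIf_pos ((h R hR).2 rfl)]
  · exact fun R' hR' hne => onlyIf_neg fun hi => hne ((h R' hR').1 hi)
  · exact fun h => absurd hR h

/-- Expanding the right side over all relations R contained in `sameSide S`, the non-zero terms are
those in which R induces a non-crossing partition on S and on every component. By gluing, such an R
is the graph of a unique L, which is compatible with S. -/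
theorem sum_compat_restr {n : ℕ} (a : Fin n → A) (S : Finset (Fin n)) :
    ∑ L : NC n, onlyIf (Compat L S)
      (restr K L a S ⊗ₜ[K] ((components S).map (restr K L a)).prod) =
    tensorMapSq (splitLetter K A) (letter (wordTA K A) S a ⊗ₜ
      ((components S).map fun J => letter (wordTA K A) J a).prod) := by
  classical
  have hdisj : ∀ {B C : Finset (Fin n)}, Disjoint B C → Disjoint (B ×ˢ B) (C ×ˢ C) :=
    fun h => Finset.disjoint_product.2 (Or.inl h)
  have hdisjS : Disjoint (S ×ˢ S) (listUnion (fun J => J ×ˢ J) (components S)) := by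
    rw [Finset.disjoint_left]
    intro x hx hx'
    obtain ⟨J, hJ, hxJ⟩ := mem_listUnion.1 hx'
    exact (exists_mem_components_iff S x.1).1 ⟨J, hJ, (Finset.mem_product.1 hxJ).1⟩
      (Finset.mem_product.1 hx).1
  have hprod : tensorMapSq (splitLetter K A) (letter (wordTA K A) S a ⊗ₜ
      ((components S).map fun J => letter (wordTA K A) J a).prod) =
      ∑ R ∈ (sameSide S).powerset, decoratedBy K a S R ⊗ₜ[K]
        ((components S).map fun J => decoratedBy K a J R).prod := by
    rw [Algebra.TensorProduct.map_tmul, map_list_prod, List.map_map, tensorMap_letter_eq_sum]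
    have hmap : (components S).map (tensorMap (splitLetter K A) ∘
        fun J => letter (wordTA K A) J a) = (components S).map fun J =>
          ∑ R ∈ (J ×ˢ J).powerset, decoratedBy K a J R :=
      List.map_congr_left fun J _ => tensorMap_letter_eq_sum a J
    rw [hmap, prod_sum_powerset (fun J => J ×ˢ J) (fun J R => decoratedBy K a J R) _
      ((components_pairwise S).imp hdisj), TensorProduct.sum_tmul]
    simp only [TensorProduct.tmul_sum]
    rw [← sum_powerset_union hdisjS (fun R₁ R₂ => decoratedBy K a S R₁ ⊗ₜ[K]
      ((components S).map fun J => decoratedBy K a J (R₂ ∩ J ×ˢ J)).prod)]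
    refine Finset.sum_congr rfl fun R _ => ?_
    rw [decoratedBy_inter]
    congr 2
    refine List.map_congr_left fun J hJ => ?_
    rw [Finset.inter_assoc,
      Finset.inter_eq_right.2 fun x hx =>
        (mem_listUnion (E := fun J : Finset (Fin n) => J ×ˢ J)).2 ⟨J, hJ, hx⟩,
      decoratedBy_inter]
  rw [hprod, sum_onlyIf]
  -- The compatible L embed through their graphs into the relations R. What remains is that terms
  -- outside the image vanish and that matching terms agree.
  refine Finset.sum_of_injOn graphOf graphOf_injective.injOn ?_ ?_ ?_
  · intro L hL
    simp only [Finset.coe_filter, Finset.mem_univ, true_and, Set.mem_ofPred_eq] at hL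
    exact Finset.mem_coe.2 (Finset.mem_powerset.2 (compat_iff_graphOf_subset.1 hL))
  · intro R hR hnot
    rw [Finset.mem_powerset] at hR
    by_contra hne
    refine hnot ?_
    have hS : decoratedBy K a S R ≠ 0 := fun h => hne (by rw [h, TensorProduct.zero_tmul])
    have hJ : ∀ J ∈ components S, decoratedBy K a J R ≠ 0 := fun J hJ h => hne (by
      rw [List.prod_eq_zero (List.mem_map.2 ⟨J, hJ, h⟩), TensorProduct.tmul_zero])
    obtain ⟨L, rfl⟩ := exists_graphOf_eq hR (exists_induces_of_decoratedBy_ne_zero hS)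
      fun J hJ' => exists_induces_of_decoratedBy_ne_zero (hJ J hJ')
    exact ⟨L, by simpa using compat_iff_graphOf_subset.2 hR, rfl⟩
  · intro L _
    simp only [decoratedBy_graphOf]

/-- After exchanging the sums over L and over S, the equality holds for each S separately. Hence one
argument covers the full coproduct and both of its halves. -/
theorem tensorMapSq_coprodTA (p : SubsetCond) (v : TA K A) :
    tensorMapSq (splitLetter K A) (coprodTA K A p v) = coprodNCA K A p (splitLetter K A v) := by
  induction v using TA.induction with
  | zero => simp only [map_zero]
  | add x y hx hy => simp only [map_add, hx, hy]
  | smul c x hx => simp only [map_smul, hx]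
  | word n h a =>
    rw [coprodTA_word, splitLetter_word, map_sum, map_sum]
    simp only [coprodNCA_decorated]
    rw [Finset.sum_comm]
    refine Finset.sum_congr rfl fun S _ => ?_
    by_cases hS : p ⟨n, h⟩ S
    · rw [onlyIf_pos hS, ← sum_compat_restr]
      exact Finset.sum_congr rfl fun L _ => onlyIf_congr (and_iff_left hS).symm rfl
    · rw [onlyIf_neg hS, map_zero]
      exact (Finset.sum_eq_zero fun L _ => onlyIf_neg fun H => hS H.2).symm

variable (K A) in
/-- The projection of decorated non-crossing partitions onto words that extracts the
coefficients of the discrete partitions. -/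
noncomputable def discreteCoeff : NCA K A →ₗ[K] TA K A :=
  DirectSum.toModule K ℕ+ _ fun n => liftNC K A fun L : NC (n : ℕ) =>
    onlyIf (L = NC.discrete n) (DirectSum.lof K ℕ+ (fun n => ⨂[K]^(n : ℕ) A) n)

theorem discreteCoeff_decorated {n : ℕ} (h : 0 < n) (L : NC n) (a : Fin n → A) :
    discreteCoeff K A (decorated K A h L a) = onlyIf (L = NC.discrete n) (word K A h a) := by
  have key : ∀ (n : ℕ+) (L : NC n) (a : Fin n → A), discreteCoeff K A
      (DirectSum.lof K ℕ+ (fun n => (NC (n : ℕ) →₀ K) ⊗[K] (⨂[K]^(n : ℕ) A)) n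
        (Finsupp.single L 1 ⊗ₜ PiTensorProduct.tprod K a)) = onlyIf (L = NC.discrete n)
          (DirectSum.lof K ℕ+ (fun n => ⨂[K]^(n : ℕ) A) n (PiTensorProduct.tprod K a)) := by
    intro n L a
    rw [discreteCoeff, DirectSum.toModule_lof, liftNC, TensorProduct.lift.tmul,
      Finsupp.linearCombination_single, one_smul]
    by_cases hL : L = NC.discrete n
    · rw [onlyIf_pos hL, onlyIf_pos hL]
    · rw [onlyIf_neg hL, onlyIf_neg hL, LinearMap.zero_apply]
  exact key ⟨n, h⟩ L a

/-- The discrete partition occurs exactly once in the sum over NC_n. This left inverse is what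
transfers the shuffle axioms from decorated partitions to words. -/
theorem discreteCoeff_splitLetter (v : TA K A) : discreteCoeff K A (splitLetter K A v) = v := by
  induction v using TA.induction with
  | zero => simp
  | add x y hx hy => rw [map_add, map_add, hx, hy]
  | smul c x hx => rw [map_smul, map_smul, hx]
  | word n h a =>
    rw [splitLetter_word, map_sum]
    simp only [discreteCoeff_decorated]
    rw [Finset.sum_eq_single (NC.discrete n), onlyIf_pos rfl]
    · exact fun L _ hL => onlyIf_neg hL
    · exact fun h => absurd (Finset.mem_univ _) h

variable (K A) in
theorem isMorphism_SpDual : (dualNCA K A).IsMorphism (dualTA K A) (SpDual K A) :=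
  isMorphism_transpose_tensorMap
    (extendHalf_tensorMap (tensorMapSq_coprodTA hasFirst) (tensorMapSq_coprodTA anySubset))
    (extendHalf_tensorMap (tensorMapSq_coprodTA lacksFirst) (tensorMapSq_coprodTA anySubset))

end SplittingMap

end SplittingProcess

theorem mainTheorem7 (K : Type*) [Field K] [CharZero K] (A : Type*) [Ring A] [Algebra K A] :
    (SplittingProcess.dualNCA K A).IsUnitalShuffleAlgebra ∧
    (SplittingProcess.dualTA K A).IsUnitalShuffleAlgebra ∧
    (SplittingProcess.dualNCA K A).IsMorphism (SplittingProcess.dualTA K A)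
      (SplittingProcess.SpDual K A) :=
  have h := (SplittingProcess.isUnshuffle_coprodNCA K A).isUnitalShuffleAlgebra
  have h' := SplittingProcess.isMorphism_SpDual K A
  ⟨h, SplittingProcess.isUnitalShuffleAlgebra_of_tensorMap
    SplittingProcess.discreteCoeff_splitLetter h h', h'⟩
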